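/- Consider the plant $\dot z = Az + B\psi(Sz) + Nw$, $y = Cz+\eta$, with $z\in\mathbb R^{n_z}$, $y,\eta\in\mathbb R^{n_y}$, $w\in\mathbb R^{n_w}$, where $\psi:\mathbb R^{n_q}\to\mathbb R^{n_s}$ is Lipschitz with constant $\ell>0$ and $A,B,C,N,S$ are real matrices of matching sizes. The output $y$ is available only at times $t_1<t_2<\dots$ with $0\le t_1\le T_2$ and $T_1\le t_{k+1}-t_k\le T_2$, where $0<T_1\le T_2$. For gains $L\in\mathbb R^{n_z\times n_y}$, $H\in\mathbb R^{n_y\times n_y}$ consider the observer $$\dot{\hat z}=A\hat z+B\psi(S\hat z)+L\theta,\quad \dot\theta=H\theta\quad (t\ne t_k),\qquad \hat z(t_k^+)=\hat z(t_k),\quad \theta(t_k^+)=y(t_k)-C\hat z(t_k),$$ and the performance output $y_p=C_p(z-\hat z)$, with $C_p\in\mathbb R^{n_p\times n_z}$. Model the interconnection as a hybrid system with state $x=(z,\hat z,\theta,\tau)$ and input $u=(w,\eta)$, where $\tau$ is a timer: $\dot\tau=-1$ while $\tau\in[0,T_2]$, a measurement arrives when $\tau=0$, and then $\tau^+\in[T_1,T_2]$.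 Let $\mathcal A$ be the set of states with $z=\hat z$, $\theta=0$, $\tau\in[0,T_2]$. Write $\operatorname{He}(M)=M+M^{\mathsf T}$; matrix inequalities are between symmetric matrices, and $\bullet$ denotes a block determined by symmetry. Let $\lambda_t,\gamma>0$. Suppose that there are symmetric positive definite $P_1\in\mathbb R^{n_z\times n_z}$, $P_2\in\mathbb R^{n_y\times n_y}$, reals $\delta,\chi>0$, and matrices $X\in\mathbb R^{n_z\times n_z}$, $U,W\in\mathbb R^{n_y\times n_y}$, $J\in\mathbb R^{n_z\times n_y}$ such that, for $\tau=0$ and for $\tau=T_2$, $$\begin{pmatrix}\operatorname{He}(R_1)&R_2+\mathcal P_\tau&R_3&R_4\\ \bullet&\mathcal N_\tau+\operatorname{He}(R_5)&R_3&R_4\\ \bullet&\bullet&-\gamma^2I&0\\ \bullet&\bullet&\bullet&-\chi I\end{pmatrix}<0,$$ where $\mathcal P_\tau=\operatorname{diag}(P_1,e^{\delta\tau}P_2)$, $\mathcal N_\tau=\operatorname{diag}(2\lambda_tP_1+C_p^{\mathsf T}C_p+\chi\ell^2S^{\mathsf T}S,\ (2\lambda_t-\delta)e^{\delta\tau}P_2)$,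 $$R_1=\begin{pmatrix}-X&C^{\mathsf T}U\\0&-U\end{pmatrix},\quad R_2=\begin{pmatrix}-X+X^{\mathsf T}A-JC&J+C^{\mathsf T}U\\-WC&-U+W\end{pmatrix},\quad R_3=\begin{pmatrix}X^{\mathsf T}N\\0\end{pmatrix},\quad R_4=\begin{pmatrix}X^{\mathsf T}B\\0\end{pmatrix},\quad R_5=\begin{pmatrix}A^{\mathsf T}X-C^{\mathsf T}J^{\mathsf T}&-C^{\mathsf T}W^{\mathsf T}\\J^{\mathsf T}&W^{\mathsf T}\end{pmatrix}.$$ Then $X$ and $U$ are nonsingular, and the observer with $L=X^{-\mathsf T}J$ and $H=U^{-\mathsf T}W$ has the following properties. (P1) For $w\equiv0$, $\eta\equiv0$, the set $\mathcal A$ is globally exponentially stable with convergence rate $\lambda_t$: maximal solutions are complete, and for some $\kappa,\lambda>0$ every solution $\phi$ satisfies, at all its hybrid times $(t,j)$, $|\phi(t,j)|_{\mathcal A}\le\kappa e^{-\lambda(t+j)}|\phi(0,0)|_{\mathcal A}$ and $|\phi(t,j)|_{\mathcal A}\le\kappa e^{-\lambda_t t}|\phi(0,0)|_{\mathcal A}$.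 (P2) The system is exponentially input-to-state stable with respect to $\mathcal A$: maximal solutions (for inputs that are bounded on bounded hybrid time intervals) are complete, and for some $\kappa,\lambda>0$ and some $\rho$ of class $\mathcal K$ every solution with $\|u\|_\infty<\infty$ satisfies $|\phi(t,j)|_{\mathcal A}\le\max\{\kappa e^{-\lambda(t+j)}|\phi(0,0)|_{\mathcal A},\rho(\|u\|_\infty)\}$; in particular $z-\hat z$ is bounded when $w$ and $\eta$ are bounded. (P3) There is $\alpha>0$ such that every solution with $\eta\equiv0$ satisfies $\|y_p\|_2\le\alpha|\phi(0,0)|_{\mathcal A}+\gamma\|w\|_2$, where the $L_2$ norms are taken over the ordinary time in the domain of the solution. The restriction $\delta>2\lambda_t$ is not needed: there are a plant with $n_z,n_y\ge1$ and reals $T_2,\lambda_t,\gamma>0$ for which the above matrix inequalities are feasible with some $\delta<2\lambda_t$. -/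

import Mathlib

open MeasureTheory Set Filter
open scoped ENNReal NNReal Matrix

noncomputable section

namespace SporadicObserver

/-- `ℝⁿ` with its Euclidean norm. -/
abbrev E (n : ℕ) : Type := EuclideanSpace ℝ (Fin n)

/-! ### Hybrid time domains and hybrid signals

A hybrid signal is a function of `(t, j)`; only its values on its domain, a subset of
`ℝ × ℕ` carried along separately, are ever used. -/

/-- The interval `{t | (t, j) ∈ D}`. -/
def slice (D : Set (ℝ × ℕ)) (j : ℕ) : Set ℝ := {t | (t, j) ∈ D}

/-- A hybrid time domain: the union of an infinite sequence of intervals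
`[t_j, t_{j+1}] × {j}`, `0 = t_0 ≤ t_1 ≤ …`, or of a finite one, in which case the last interval
is `[t_J, T]` or `[t_J, T)` or `[t_J, ∞)`. -/
def IsHybridTimeDomain (D : Set (ℝ × ℕ)) : Prop :=
  ∃ t : ℕ → ℝ, t 0 = 0 ∧ Monotone t ∧
    ((∀ j, slice D j = Icc (t j) (t (j + 1))) ∨
      ∃ J : ℕ, (∀ j < J, slice D j = Icc (t j) (t (j + 1))) ∧ (∀ j, J < j → slice D j = ∅) ∧
        ((∃ T, t J ≤ T ∧ slice D J = Icc (t J) T) ∨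
          (∃ T, t J < T ∧ slice D J = Ico (t J) T) ∨
          slice D J = Ici (t J)))

/-- The hybrid times of `D` at which a jump occurs. -/
def jumpTimes (D : Set (ℝ × ℕ)) : Set (ℝ × ℕ) := {p | p ∈ D ∧ (p.1, p.2 + 1) ∈ D}

/-- The ordinary times occurring in `D`. -/
def ordinaryTimes (D : Set (ℝ × ℕ)) : Set ℝ := {t | ∃ j, (t, j) ∈ D}

/-- `j(t)`: the least `j` with `(t, j) ∈ D`. -/
def firstIndex (D : Set (ℝ × ℕ)) (t : ℝ) : ℕ := sInf {j | (t, j) ∈ D}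

section Signals

variable {U : Type*} [NormedAddCommGroup U]

/-- A hybrid input: on each interval, Lebesgue measurable and locally essentially bounded. -/
def IsHybridInput (D : Set (ℝ × ℕ)) (u : ℝ → ℕ → U) : Prop :=
  ∀ j, AEStronglyMeasurable (fun t => u t j) (volume.restrict (slice D j)) ∧
    ∀ a b, Icc a b ⊆ slice D j → ∃ M : ℝ, ∀ᵐ t ∂volume.restrict (Icc a b), ‖u t j‖ ≤ M

/-- A hybrid arc: on each interval, locally absolutely continuous. -/
def IsHybridArc (D : Set (ℝ × ℕ)) (φ : ℝ → ℕ → U) : Prop :=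
  ∀ j a b, a ≤ b → Icc a b ⊆ slice D j →
    AbsolutelyContinuousOnInterval (fun t => φ t j) a b

/-- The `T`-truncated `L∞` norm of a hybrid signal: the larger of the essential supremum outside
the jump times and the supremum over the jump times, both over hybrid times with `s + k ≤ T`. -/
def truncNorm (D : Set (ℝ × ℕ)) (u : ℝ → ℕ → U) (T : ℝ) : ℝ≥0∞ :=
  max (⨆ k : ℕ, essSup (fun s => ‖u s k‖ₑ)
      (volume.restrict {s | (s, k) ∈ D \ jumpTimes D ∧ s + k ≤ T}))
    (⨆ p ∈ {p : ℝ × ℕ | p ∈ jumpTimes D ∧ p.1 + p.2 ≤ T}, ‖u p.1 p.2‖ₑ)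

/-- The `L∞` norm of a hybrid signal, the limit of the (monotone) truncated norms. -/
def supNorm (D : Set (ℝ × ℕ)) (u : ℝ → ℕ → U) : ℝ≥0∞ := ⨆ T : ℝ, truncNorm D u T

/-- `(∫ |v(s, j(s))|² ds)^{1/2}` over the ordinary times of `D`, as an extended real. -/
def l2Norm (D : Set (ℝ × ℕ)) (v : ℝ → ℕ → U) : ℝ≥0∞ :=
  (∫⁻ s in ordinaryTimes D, ‖v s (firstIndex D s)‖ₑ ^ 2) ^ (1 / 2 : ℝ)

end Signals

/-! ### Hybrid systems with inputs -/

/-- `ẋ = f(x, w)` for `x ∈ C`, and `x⁺ ∈ G(x, η)` for `x ∈ D`. -/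
structure HybridSystem (X W V : Type*) where
  flowMap : X → W → X
  flowSet : Set X
  jumpMap : X → V → Set X
  jumpSet : Set X

section Solutions

variable {X W V : Type*} [NormedAddCommGroup X] [NormedSpace ℝ X]
  [NormedAddCommGroup W] [NormedAddCommGroup V]

/-- `(φ, u)`, with `u = (w, η)` and common domain `D`, is a solution pair of `H`. -/
structure IsSolutionPair (H : HybridSystem X W V) (D : Set (ℝ × ℕ)) (φ : ℝ → ℕ → X)
    (u : ℝ → ℕ → WithLp 2 (W × V)) : Prop where
  domain : IsHybridTimeDomain D
  input : IsHybridInput D u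
  arc : IsHybridArc D φ
  init : φ 0 0 ∈ closure H.flowSet ∪ H.jumpSet
  flow_mem : ∀ j, ∀ t ∈ interior (slice D j), φ t j ∈ H.flowSet
  flow_eq : ∀ j, ∀ᵐ t ∂volume.restrict (interior (slice D j)),
    HasDerivAt (fun s => φ s j) (H.flowMap (φ t j) (u t j).fst) t
  jump : ∀ p ∈ jumpTimes D, φ p.1 p.2 ∈ H.jumpSet ∧
    φ p.1 (p.2 + 1) ∈ H.jumpMap (φ p.1 p.2) (u p.1 p.2).snd

/-- The input vanishes identically on `D`. -/
def IsZeroInput {U : Type*} [NormedAddCommGroup U] (D : Set (ℝ × ℕ)) (u : ℝ → ℕ → U) : Prop :=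
  ∀ p ∈ D, u p.1 p.2 = 0

/-- The input is bounded on each bounded piece of `D` (so it does not blow up at a missing
right endpoint of a bounded domain). -/
def IsBoundedOnBounded {U : Type*} [NormedAddCommGroup U] (D : Set (ℝ × ℕ))
    (u : ℝ → ℕ → U) : Prop :=
  ∀ T, truncNorm D u T < ∞

/-- Every solution pair with input in the class `K` that has no proper extension with input in
`K` is complete, i.e. its domain is unbounded. -/
def MaximalAreComplete (H : HybridSystem X W V)
    (K : Set (ℝ × ℕ) → (ℝ → ℕ → WithLp 2 (W × V)) → Prop) : Prop :=
  ∀ D φ u, IsSolutionPair H D φ u → K D u →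
    (∀ D' φ' u', IsSolutionPair H D' φ' u' → K D' u' → D ⊆ D' →
      (∀ p ∈ D, φ' p.1 p.2 = φ p.1 p.2 ∧ u' p.1 p.2 = u p.1 p.2) → D' = D) →
    ∀ r : ℝ, ∃ p ∈ D, r ≤ p.1 + p.2

/-- Functions of class `𝒦`. -/
def IsClassK (ρ : ℝ → ℝ) : Prop :=
  ContinuousOn ρ (Ici 0) ∧ StrictMonoOn ρ (Ici 0) ∧ ρ 0 = 0

/-- With zero input, the closed set `𝒜` is globally exponentially stable, and the convergence
rate with respect to ordinary time is (at least) `rate`. -/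
def IsGloballyExpStable (H : HybridSystem X W V) (𝒜 : Set X) (rate : ℝ) : Prop :=
  MaximalAreComplete H IsZeroInput ∧
  ∃ κ > 0, ∃ lam > 0, ∀ D φ u, IsSolutionPair H D φ u → IsZeroInput D u → ∀ p ∈ D,
    Metric.infDist (φ p.1 p.2) 𝒜
      ≤ κ * Real.exp (-lam * (p.1 + p.2)) * Metric.infDist (φ 0 0) 𝒜 ∧
    Metric.infDist (φ p.1 p.2) 𝒜 ≤ κ * Real.exp (-rate * p.1) * Metric.infDist (φ 0 0) 𝒜

/-- Exponential input-to-state stability with respect to the closed set `𝒜`. -/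
def IsExpISS (H : HybridSystem X W V) (𝒜 : Set X) : Prop :=
  MaximalAreComplete H IsBoundedOnBounded ∧
  ∃ κ > 0, ∃ lam > 0, ∃ ρ, IsClassK ρ ∧ ∀ D φ u, IsSolutionPair H D φ u → supNorm D u < ∞ →
    ∀ p ∈ D, Metric.infDist (φ p.1 p.2) 𝒜 ≤
      max (κ * Real.exp (-lam * (p.1 + p.2)) * Metric.infDist (φ 0 0) 𝒜)
        (ρ (supNorm D u).toReal)

end Solutions

/-! ### The plant and the observer -/

/-- The data of the plant `ż = A z + B ψ(S z) + N w`, `y = C z + η`, of the performance output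
`y_p = C_p (z - ẑ)`, and of a Lipschitz constant `ℓ > 0` of `ψ`. -/
structure Plant (nz ny nw nq ns np : ℕ) where
  A : Matrix (Fin nz) (Fin nz) ℝ
  B : Matrix (Fin nz) (Fin ns) ℝ
  C : Matrix (Fin ny) (Fin nz) ℝ
  N : Matrix (Fin nz) (Fin nw) ℝ
  S : Matrix (Fin nq) (Fin nz) ℝ
  Cp : Matrix (Fin np) (Fin nz) ℝ
  ψ : E nq → E ns
  ℓ : ℝ
  ℓ_pos : 0 < ℓ
  lipschitz : ∀ v₁ v₂, ‖ψ v₁ - ψ v₂‖ ≤ ℓ * ‖v₁ - v₂‖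

/-- The action of a matrix on Euclidean vectors. -/
abbrev app {m n : ℕ} (M : Matrix (Fin m) (Fin n) ℝ) (v : E n) : E m := Matrix.toEuclideanLin M v

/-- The states `(z, ẑ, θ, τ)` of the plant, the observer and the sampling timer, with the
Euclidean norm. -/
abbrev State (nz ny : ℕ) : Type := WithLp 2 (E nz × WithLp 2 (E nz × WithLp 2 (E ny × ℝ)))

namespace State

variable {nz ny : ℕ}

def mk (z zhat : E nz) (θ : E ny) (τ : ℝ) : State nz ny :=
  WithLp.toLp 2 (z, WithLp.toLp 2 (zhat, WithLp.toLp 2 (θ, τ)))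

/-- The plant state. -/
def z (x : State nz ny) : E nz := x.fst

/-- The estimate of the plant state. -/
def zhat (x : State nz ny) : E nz := x.snd.fst

/-- The intersample injection variable of the observer. -/
def θ (x : State nz ny) : E ny := x.snd.snd.fst

/-- The time to the next measurement. -/
def τ (x : State nz ny) : ℝ := x.snd.snd.snd

/-- The estimation error. -/
def ε (x : State nz ny) : E nz := x.z - x.zhat

end State

section Observer

variable {nz ny nw nq ns np : ℕ}

/-- The plant interconnected with the observer with gains `L`, `H`. Between measurements
`ẑ' = A ẑ + B ψ(S ẑ) + L θ` and `θ' = H θ`; at a measurement `θ⁺ = y - C ẑ` with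
`y = C z + η`. The timer `τ` decreases at unit rate from a value in `[0, T₂]`; a measurement
arrives when it reaches `0`, and it is then reset to any value in `[T₁, T₂]`, so that the
measurement times are exactly the sequences with `0 ≤ t₁ ≤ T₂` and `T₁ ≤ t_{k+1} - t_k ≤ T₂`. -/
def closedLoop (pl : Plant nz ny nw nq ns np) (T₁ T₂ : ℝ)
    (L : Matrix (Fin nz) (Fin ny) ℝ) (H : Matrix (Fin ny) (Fin ny) ℝ) :
    HybridSystem (State nz ny) (E nw) (E ny) where
  flowMap x w := State.mk
    (app pl.A x.z + app pl.B (pl.ψ (app pl.S x.z)) + app pl.N w)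
    (app pl.A x.zhat + app pl.B (pl.ψ (app pl.S x.zhat)) + app L x.θ)
    (app H x.θ)
    (-1)
  flowSet := {x | x.τ ∈ Icc 0 T₂}
  jumpMap x η := {g | ∃ v ∈ Icc T₁ T₂,
    g = State.mk x.z x.zhat ((app pl.C x.z + η) - app pl.C x.zhat) v}
  jumpSet := {x | x.τ = 0}

/-- The states in which the plant state and its estimate coincide, `θ` vanishes, and the timer
is in its range. (Since `θ̃ = C (z - ẑ) - θ`, these are the states with `z - ẑ = 0`, `θ̃ = 0`.) -/
def target (nz ny : ℕ) (T₂ : ℝ) : Set (State nz ny) :=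
  {x | x.z = x.zhat ∧ x.θ = 0 ∧ x.τ ∈ Icc 0 T₂}

/-- The observer with gains `L`, `H` solves the estimation problem with prescribed convergence
rate `rate` and prescribed `L₂`-gain `γ`, for measurement times as bounded by `T₁`, `T₂`. -/
structure SolvesEstimationProblem (pl : Plant nz ny nw nq ns np) (T₁ T₂ rate γ : ℝ)
    (L : Matrix (Fin nz) (Fin ny) ℝ) (H : Matrix (Fin ny) (Fin ny) ℝ) : Prop where
  /-- Global exponential stability, with the prescribed rate, without disturbances. -/
  exp_stable : IsGloballyExpStable (closedLoop pl T₁ T₂ L H) (target nz ny T₂) rate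
  /-- Robustness to bounded disturbances: exponential input-to-state stability. -/
  exp_iss : IsExpISS (closedLoop pl T₁ T₂ L H) (target nz ny T₂)
  /-- The estimation error is bounded whenever the disturbances are bounded. -/
  error_bounded : ∀ D φ u, IsSolutionPair (closedLoop pl T₁ T₂ L H) D φ u → supNorm D u < ∞ →
    ∃ M : ℝ, ∀ p ∈ D, ‖(φ p.1 p.2).ε‖ ≤ M
  /-- `L₂`-external stability from `w` to `y_p`, with gain `γ`, when `η ≡ 0`. -/
  l2_stable : ∃ α > 0, ∀ D φ u, IsSolutionPair (closedLoop pl T₁ T₂ L H) D φ u →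
    IsZeroInput D (fun t j => (u t j).snd) →
    l2Norm D (fun t j => app pl.Cp (φ t j).ε) ≤
      ENNReal.ofReal (α * Metric.infDist (φ 0 0) (target nz ny T₂)) +
        ENNReal.ofReal γ * l2Norm D (fun t j => (u t j).fst)

/-! ### The matrix inequalities -/

/-- `He(M) = M + Mᵀ`. -/
def He {ι : Type*} (M : Matrix ι ι ℝ) : Matrix ι ι ℝ := M + Mᵀ

/-- Negative definiteness (including symmetry). -/
def NegDef {ι : Type*} (M : Matrix ι ι ℝ) : Prop := (-M).PosDef

/-- The symmetric matrix of one of the two inequalities, where `e` stands for `e^{δ τ}`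
(`τ = 0` in the first inequality, `τ = T₂` in the second one):
`[He R₁, R₂ + 𝒫, R₃, R₄; •, 𝒩 + He R₅, R₆, R₇; •, •, -γ² I, 0; •, •, •, -χ I]` with
`𝒫 = diag(P₁, e P₂)` and
`𝒩 = diag(2 λ P₁ + C_pᵀ C_p + χ ℓ² Sᵀ S, (2 λ - δ) e P₂)`. -/
def lmiMatrix (pl : Plant nz ny nw nq ns np) (lam γ δ χ e : ℝ)
    (P₁ : Matrix (Fin nz) (Fin nz) ℝ) (P₂ : Matrix (Fin ny) (Fin ny) ℝ)
    (X : Matrix (Fin nz) (Fin nz) ℝ) (U W : Matrix (Fin ny) (Fin ny) ℝ)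
    (J : Matrix (Fin nz) (Fin ny) ℝ) :
    Matrix (((Fin nz ⊕ Fin ny) ⊕ (Fin nz ⊕ Fin ny)) ⊕ (Fin nw ⊕ Fin ns))
      (((Fin nz ⊕ Fin ny) ⊕ (Fin nz ⊕ Fin ny)) ⊕ (Fin nw ⊕ Fin ns)) ℝ :=
  let Pdiag : Matrix (Fin nz ⊕ Fin ny) (Fin nz ⊕ Fin ny) ℝ := Matrix.fromBlocks P₁ 0 0 (e • P₂)
  let Ndiag : Matrix (Fin nz ⊕ Fin ny) (Fin nz ⊕ Fin ny) ℝ := Matrix.fromBlocks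
    ((2 * lam) • P₁ + pl.Cpᵀ * pl.Cp + (χ * pl.ℓ ^ 2) • (pl.Sᵀ * pl.S)) 0
    0 (((2 * lam - δ) * e) • P₂)
  let R₁ : Matrix (Fin nz ⊕ Fin ny) (Fin nz ⊕ Fin ny) ℝ := Matrix.fromBlocks
    (-X) (pl.Cᵀ * U)
    0 (-U)
  let R₂ : Matrix (Fin nz ⊕ Fin ny) (Fin nz ⊕ Fin ny) ℝ := Matrix.fromBlocks
    (-X + Xᵀ * pl.A - J * pl.C) (J + pl.Cᵀ * U)
    (-(W * pl.C)) (-U + W)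
  let R₃ : Matrix (Fin nz ⊕ Fin ny) (Fin nw) ℝ := Matrix.fromRows (Xᵀ * pl.N) 0
  let R₄ : Matrix (Fin nz ⊕ Fin ny) (Fin ns) ℝ := Matrix.fromRows (Xᵀ * pl.B) 0
  let R₅ : Matrix (Fin nz ⊕ Fin ny) (Fin nz ⊕ Fin ny) ℝ := Matrix.fromBlocks
    (pl.Aᵀ * X - pl.Cᵀ * Jᵀ) (-(pl.Cᵀ * Wᵀ))
    Jᵀ Wᵀ
  let R₆ : Matrix (Fin nz ⊕ Fin ny) (Fin nw) ℝ := Matrix.fromRows (Xᵀ * pl.N) 0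
  let R₇ : Matrix (Fin nz ⊕ Fin ny) (Fin ns) ℝ := Matrix.fromRows (Xᵀ * pl.B) 0
  Matrix.fromBlocks
    (Matrix.fromBlocks (He R₁) (R₂ + Pdiag) (R₂ + Pdiag)ᵀ (Ndiag + He R₅))
    (Matrix.fromBlocks R₃ R₄ R₆ R₇)
    (Matrix.fromBlocks R₃ R₄ R₆ R₇)ᵀ
    (Matrix.fromBlocks (-(γ ^ 2) • 1) 0 0 (-χ • 1))

/-- Both matrix inequalities hold, with `P₁`, `P₂` symmetric positive definite and `δ`, `χ`
positive. -/
structure LMIsFeasibleAt (pl : Plant nz ny nw nq ns np) (T₂ lam γ δ χ : ℝ)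
    (P₁ : Matrix (Fin nz) (Fin nz) ℝ) (P₂ : Matrix (Fin ny) (Fin ny) ℝ)
    (X : Matrix (Fin nz) (Fin nz) ℝ) (U W : Matrix (Fin ny) (Fin ny) ℝ)
    (J : Matrix (Fin nz) (Fin ny) ℝ) : Prop where
  P₁_pos : P₁.PosDef
  P₂_pos : P₂.PosDef
  δ_pos : 0 < δ
  χ_pos : 0 < χ
  lmi_zero : NegDef (lmiMatrix pl lam γ δ χ 1 P₁ P₂ X U W J)
  lmi_T₂ : NegDef (lmiMatrix pl lam γ δ χ (Real.exp (δ * T₂)) P₁ P₂ X U W J)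

end Observer

end SporadicObserver

end

open scoped Topology

noncomputable section

/-! ### Absolutely continuous functions -/

namespace AbsolutelyContinuousOnInterval

variable {F G : Type*} [PseudoMetricSpace F] [PseudoMetricSpace G]

/-! In the coordinates ε = z - ẑ and θ̃ = Cε - θ, flows satisfy ε' = Aε + Bζ + Nw - Lθ, where ζ =
ψ(Sz) - ψ(Sẑ) obeys |ζ| ≤ ℓ|Sε|, and a measurement keeps ε and sets θ̃ to -η. The Lyapunov function
is V = εᵀP₁ε + e^{δτ} θ̃ᵀP₂θ̃ (`lyap`); since τ' = -1, its weight contributes -δ e^{δτ} θ̃ᵀP₂θ̃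
along flows.

Evaluated at (ε', θ̃', ε, θ̃, w, ζ), the quadratic form of the matrix is V' + 2λ_t V + |C_p ε|² -
γ²|w|² + χ(ℓ²|Sε|² - |ζ|²), plus multiplier terms in X, U, J, W that vanish along the dynamics
because J = XᵀL and W = UᵀH (`lmiMatrix_quadForm`, `LMIsFeasibleAt.dissipation`). The form is affine
in e^{δτ}, so negativity at τ = 0 and τ = T₂ suffices. Hence V' ≤ -2λ_t V - |y_p|² + γ²|w|² on
flows, while V grows by at most e^{δT₂} ηᵀP₂η at jumps. No sign of 2λ_t - δ enters.

The three properties follow from these two inequalities. Adding a multiple of e^{2λ_t τ} to the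
comparison function absorbs the jump increments (`exists_lyap_bound`). As V is comparable to the
squared distance to the target, this gives decay at rate λ_t in t, and decay in t + j because T₁ j ≤
t + T₂ (`jump_count_le`). Integrating the flow inequality gives the L₂ gain
(`lyap_add_lintegral_le`). Completeness is separate: the vector field has linear growth, and from
every state in the flow set one can jump or flow, so an incomplete solution extends
(`CanContinue.exists_extension`).

Nonsingularity of X and U comes from testing the strict inequality on a kernel vector; the last
claim is a scalar example checked by sums of squares. -/

theorem comp_lipschitzOnWith {f : ℝ → F} {q : F → G} {s : Set F} {K : ℝ≥0} {a b : ℝ}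
    (hf : AbsolutelyContinuousOnInterval f a b) (hq : LipschitzOnWith K q s)
    (hs : ∀ t ∈ uIcc a b, f t ∈ s) : AbsolutelyContinuousOnInterval (fun t => q (f t)) a b := by
  unfold AbsolutelyContinuousOnInterval at hf ⊢
  refine squeeze_zero' ?_ ?_ (by simpa using hf.const_mul (K : ℝ))
  · exact Eventually.of_forall fun _ => Finset.sum_nonneg fun _ _ => dist_nonneg
  rw [eventually_inf_principal]
  filter_upwards with E hE
  rw [Finset.mul_sum]
  exact Finset.sum_le_sum fun i hi =>
    hq.dist_le_mul _ (hs _ (hE.1 i hi).1) _ (hs _ (hE.1 i hi).2)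

/-- An absolutely continuous function stays in a closed ball, which is compact and convex, and a C¹
map is Lipschitz there. -/
theorem comp_contDiff {F : Type*} [NormedAddCommGroup F] [NormedSpace ℝ F] [FiniteDimensional ℝ F]
    {G : Type*} [NormedAddCommGroup G] [NormedSpace ℝ G]
    {f : ℝ → F} {q : F → G} {a b : ℝ}
    (hf : AbsolutelyContinuousOnInterval f a b) (hq : ContDiff ℝ 1 q) :
    AbsolutelyContinuousOnInterval (fun t => q (f t)) a b := by
  obtain ⟨M, hM⟩ := hf.exists_bound
  have := FiniteDimensional.proper_real F
  obtain ⟨K, hK⟩ := (hq.contDiffOn (s := Metric.closedBall (0 : F) M)).exists_lipschitzOnWith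
    (by decide) (convex_closedBall _ _) (isCompact_closedBall _ _)
  exact hf.comp_lipschitzOnWith hK fun t ht => by simpa using hM t ht

/-- Freezing an absolutely continuous function to the right of `c`. -/
theorem comp_min {f : ℝ → F} {a b c : ℝ} (hab : a ≤ b)
    (hf : AbsolutelyContinuousOnInterval f a c) (hac : a ≤ c) :
    AbsolutelyContinuousOnInterval (fun t => f (min t c)) a b := by
  rw [absolutelyContinuousOnInterval_iff] at hf ⊢
  intro ε hε
  obtain ⟨δ, hδ, h⟩ := hf ε hε
  refine ⟨δ, hδ, fun E hE hlen => ?_⟩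
  refine h (E.1, fun i => (min (E.2 i).1 c, min (E.2 i).2 c)) ⟨fun i hi => ?_, ?_⟩ ?_
  · have := hE.1 i hi
    simp only [uIcc_of_le hab, uIcc_of_le hac, mem_Icc] at this ⊢
    grind
  · refine hE.2.mono fun i x hx => ?_
    simp only [mem_uIoc] at hx ⊢
    grind
  · refine lt_of_le_of_lt (Finset.sum_le_sum fun i _ => ?_) hlen
    simp only [Real.dist_eq]
    simpa using abs_min_sub_min_le_max (E.2 i).1 c (E.2 i).2 c

/-- The fundamental theorem of calculus for absolutely continuous functions; the endpoints are null,
so the open interval suffices. -/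
theorem sub_le_integral {g g' h : ℝ → ℝ} {a b : ℝ} (hab : a ≤ b)
    (hg : AbsolutelyContinuousOnInterval g a b)
    (hd : ∀ᵐ t, t ∈ Ioo a b → HasDerivAt g (g' t) t ∧ g' t ≤ h t)
    (hh : IntegrableOn h (Ioc a b)) : g b - g a ≤ ∫ t in Ioc a b, h t := by
  rw [← hg.integral_deriv_eq_sub, intervalIntegral.integral_of_le hab,
    integral_Ioc_eq_integral_Ioo, integral_Ioc_eq_integral_Ioo]
  have h1 := (intervalIntegrable_iff_integrableOn_Ioc_of_le hab).1 hg.intervalIntegrable_deriv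
  refine integral_mono_ae (h1.mono_set Ioo_subset_Ioc_self) (hh.mono_set Ioo_subset_Ioc_self) ?_
  rw [EventuallyLE, ae_restrict_iff' measurableSet_Ioo]
  filter_upwards [hd] with t ht hm
  rw [(ht hm).1.deriv]
  exact (ht hm).2

theorem le_of_ae_deriv_nonpos {g g' : ℝ → ℝ} {a b : ℝ} (hab : a ≤ b)
    (hg : AbsolutelyContinuousOnInterval g a b)
    (h : ∀ᵐ t, t ∈ Ioo a b → HasDerivAt g (g' t) t ∧ g' t ≤ 0) : g b ≤ g a := by
  simpa using hg.sub_le_integral (h := 0) hab h integrableOn_zero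

variable {F : Type*} [NormedAddCommGroup F] [InnerProductSpace ℝ F]

theorem inner_left {f : ℝ → F} {a b : ℝ} (c : F) (hf : AbsolutelyContinuousOnInterval f a b) :
    AbsolutelyContinuousOnInterval (fun t => inner ℝ c (f t)) a b :=
  hf.comp_lipschitzOnWith (s := univ) (innerSL ℝ c).lipschitz.lipschitzOnWith
    fun _ _ => mem_univ _

/-- Pairing f with the increment c = f b - f a reduces to the scalar case: ‖c‖² ≤ ‖c‖ M (b - a). -/
theorem norm_sub_le_of_ae_norm_deriv_le {f f' : ℝ → F} {a b M : ℝ} (hab : a ≤ b)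
    (hf : AbsolutelyContinuousOnInterval f a b)
    (h : ∀ᵐ t, t ∈ Ioo a b → HasDerivAt f (f' t) t ∧ ‖f' t‖ ≤ M) :
    ‖f b - f a‖ ≤ M * (b - a) := by
  set c := f b - f a with hc
  have h1 := (hf.inner_left c).sub_le_integral (g' := fun t => inner ℝ c (f' t))
    (h := fun _ => ‖c‖ * M) hab ?_ (integrableOn_const measure_Ioc_lt_top.ne)
  · rw [← inner_sub_right, ← hc, real_inner_self_eq_norm_sq] at h1
    simp only [integral_const, MeasurableSet.univ, measureReal_restrict_apply, univ_inter,
      Real.volume_real_Ioc_of_le hab, smul_eq_mul] at h1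
    rcases (norm_nonneg c).eq_or_lt with h0 | h0
    · rw [← h0]
      rcases hab.eq_or_lt with rfl | hlt
      · simp
      -- M is not assumed nonnegative; for c = 0 its sign is read off from one point where the
      -- derivative bound holds.
      have hfr : ∃ᵐ t, t ∈ Ioo a b := by
        rw [frequently_ae_iff]
        change ¬volume (Ioo a b) = 0
        simpa using hlt
      obtain ⟨t, ht⟩ := (hfr.and_eventually h).exists
      exact mul_nonneg ((norm_nonneg _).trans (ht.2 ht.1).2) (by linarith)
    · nlinarith
  · filter_upwards [h] with t ht hm
    refine ⟨?_, (real_inner_le_norm _ _).trans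
      (mul_le_mul_of_nonneg_left (ht hm).2 (norm_nonneg _))⟩
    simpa using (hasDerivAt_const t c).inner ℝ (ht hm).1

/-- A Grönwall bound for absolutely continuous functions with derivative of linear growth. -/
theorem norm_sq_add_one_le {f f' : ℝ → F} {a b k : ℝ} [FiniteDimensional ℝ F] (hab : a ≤ b)
    (hk : 0 ≤ k) (hf : AbsolutelyContinuousOnInterval f a b)
    (h : ∀ᵐ t, t ∈ Ioo a b → HasDerivAt f (f' t) t ∧ ‖f' t‖ ≤ k * (‖f t‖ + 1)) :
    ‖f b‖ ^ 2 + 1 ≤ Real.exp (4 * k * (b - a)) * (‖f a‖ ^ 2 + 1) := by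
  -- Unlike the norm, its square is smooth at 0. With x = ‖f t‖, the inequality 2x(x + 1) ≤ 4(x² +
  -- 1) explains the rate 4k.
  have h1 : AbsolutelyContinuousOnInterval (fun t => ‖f t‖ ^ 2 + 1) a b :=
    hf.comp_contDiff (q := fun x => ‖x‖ ^ 2 + 1) ((contDiff_norm_sq ℝ).add contDiff_const)
  have h2 : AbsolutelyContinuousOnInterval (fun t => Real.exp (-(4 * k) * t)) a b :=
    (ContDiff.contDiffOn (by fun_prop)).absolutelyContinuousOnInterval
  have h3 := (h2.fun_mul h1).le_of_ae_deriv_nonpos (g' := fun t =>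
    Real.exp (-(4 * k) * t) * (-(4 * k)) * (‖f t‖ ^ 2 + 1) +
      Real.exp (-(4 * k) * t) * (2 * inner ℝ (f t) (f' t))) hab ?_
  · have h4 : Real.exp (4 * k * (b - a)) = Real.exp (4 * k * b) * Real.exp (-(4 * k) * a) := by
      rw [← Real.exp_add]; ring_nf
    have h5 : Real.exp (4 * k * b) * Real.exp (-(4 * k) * b) = 1 := by
      rw [← Real.exp_add]; ring_nf; exact Real.exp_zero
    rw [h4]
    have := mul_le_mul_of_nonneg_left h3 (Real.exp_pos (4 * k * b)).le
    rw [← mul_assoc, h5] at this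
    linarith
  · filter_upwards [h] with t ht hm
    obtain ⟨hd, hle⟩ := ht hm
    refine ⟨?_, ?_⟩
    · have e1 : HasDerivAt (fun t => Real.exp (-(4 * k) * t))
          (Real.exp (-(4 * k) * t) * (-(4 * k))) t := by
        simpa using ((hasDerivAt_id t).const_mul (-(4 * k))).exp
      exact e1.mul (hd.norm_sq.add_const 1)
    · have e1 := real_inner_le_norm (f t) (f' t)
      have e2 : ‖f t‖ * ‖f' t‖ ≤ ‖f t‖ * (k * (‖f t‖ + 1)) :=
        mul_le_mul_of_nonneg_left hle (norm_nonneg _)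
      have e3 : 0 ≤ k * (2 * ‖f t‖ ^ 2 - 2 * ‖f t‖ + 4) :=
        mul_nonneg hk (by nlinarith [sq_nonneg (‖f t‖ - 1)])
      have e4 : -(4 * k) * (‖f t‖ ^ 2 + 1) + 2 * inner ℝ (f t) (f' t) ≤ 0 := by nlinarith
      nlinarith [mul_nonneg (Real.exp_pos (-(4 * k) * t)).le (neg_nonneg.2 e4)]

end AbsolutelyContinuousOnInterval

namespace SporadicObserver

/-! ### Hybrid time domains -/

section Domain

variable {D : Set (ℝ × ℕ)}

@[simp] theorem mem_slice {t : ℝ} {j : ℕ} : t ∈ slice D j ↔ (t, j) ∈ D := Iff.rfl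

/-- A uniform description of all the shapes of a domain, so that later arguments need no case
distinction: only the last slice can fail to be a full compact interval. -/
theorem IsHybridTimeDomain.exists_seq (hD : IsHybridTimeDomain D) :
    ∃ t : ℕ → ℝ, t 0 = 0 ∧ Monotone t ∧ (0, 0) ∈ D ∧
      (∀ j s, (s, j) ∈ D → t j ≤ s ∧ (t j, j) ∈ D ∧ Icc (t j) s ⊆ slice D j) ∧
      ∀ i j s, i < j → (s, j) ∈ D → slice D i = Icc (t i) (t (i + 1)) := by
  obtain ⟨t, h0, hmono, h⟩ := hD
  have hle : ∀ j, t j ≤ t (j + 1) := fun j => hmono (Nat.le_succ j)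
  have key : ∀ j s, slice D j = Icc (t j) (t (j + 1)) → (s, j) ∈ D →
      t j ≤ s ∧ (t j, j) ∈ D ∧ Icc (t j) s ⊆ slice D j := by
    intro j s hs hm
    rw [← mem_slice, hs] at hm
    refine ⟨hm.1, ?_, ?_⟩
    · rw [← mem_slice, hs]; exact ⟨le_rfl, hle j⟩
    · rw [hs]; exact Icc_subset_Icc_right hm.2
  refine ⟨t, h0, hmono, ?_⟩
  rcases h with h | ⟨J, h1, h2, h3⟩
  · refine ⟨?_, fun j s => key j s (h j), fun i j s _ _ => h i⟩
    rw [← mem_slice, h, ← h0]; exact ⟨le_rfl, hle 0⟩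
  · have hJ : ∀ s, (s, J) ∈ D → t J ≤ s ∧ (t J, J) ∈ D ∧ Icc (t J) s ⊆ slice D J := by
      intro s hs
      rw [← mem_slice] at hs ⊢
      rcases h3 with ⟨T, hT, h3⟩ | ⟨T, hT, h3⟩ | h3 <;> rw [h3] at hs ⊢
      · exact ⟨hs.1, ⟨le_rfl, hT⟩, Icc_subset_Icc_right hs.2⟩
      · exact ⟨hs.1, ⟨le_rfl, hT⟩, fun x hx => ⟨hx.1, hx.2.trans_lt hs.2⟩⟩
      · exact ⟨hs, self_mem_Ici, Icc_subset_Ici_self⟩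
    have hJle : ∀ j s, (s, j) ∈ D → j ≤ J := by
      intro j s hs
      by_contra hlt
      rw [← mem_slice, h2 j (not_le.1 hlt)] at hs
      exact hs
    refine ⟨?_, fun j s hs => ?_, fun i j s hij hs => h1 i (hij.trans_le (hJle j s hs))⟩
    · rcases Nat.eq_zero_or_pos J with rfl | hpos
      · rw [← h0, ← mem_slice]
        rcases h3 with ⟨T, hT, h3⟩ | ⟨T, hT, h3⟩ | h3 <;> rw [h3]
        exacts [⟨le_rfl, hT⟩, ⟨le_rfl, hT⟩, self_mem_Ici]
      · rw [← mem_slice, h1 0 hpos, ← h0]; exact ⟨le_rfl, hle 0⟩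
    · rcases (hJle j s hs).eq_or_lt with rfl | hlt
      · exact hJ s hs
      · exact key j s (h1 j hlt) hs

theorem IsHybridTimeDomain.zero_mem (hD : IsHybridTimeDomain D) : (0, 0) ∈ D := by
  obtain ⟨t, -, -, h, -⟩ := hD.exists_seq
  exact h

theorem IsHybridTimeDomain.nonneg (hD : IsHybridTimeDomain D) {p : ℝ × ℕ} (hp : p ∈ D) :
    0 ≤ p.1 := by
  obtain ⟨t, h0, hmono, -, h, -⟩ := hD.exists_seq
  exact (h0 ▸ hmono (Nat.zero_le p.2)).trans (h p.2 p.1 hp).1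

theorem IsHybridTimeDomain.ordConnected (hD : IsHybridTimeDomain D) (j : ℕ) :
    (slice D j).OrdConnected := by
  obtain ⟨t, -, -, -, h, -⟩ := hD.exists_seq
  exact ⟨fun a ha b hb => (Icc_subset_Icc_left (h j a ha).1).trans (h j b hb).2.2⟩

theorem IsHybridTimeDomain.measurableSet_slice (hD : IsHybridTimeDomain D) (j : ℕ) :
    MeasurableSet (slice D j) := (hD.ordConnected j).measurableSet

/-- Induction along a hybrid time domain. -/
theorem IsHybridTimeDomain.induction (hD : IsHybridTimeDomain D) {Q : ℝ → ℕ → Prop}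
    (zero : Q 0 0)
    (flow : ∀ j a b, a ≤ b → Icc a b ⊆ slice D j → Q a j → Q b j)
    (jump : ∀ p ∈ jumpTimes D, Q p.1 p.2 → Q p.1 (p.2 + 1)) : ∀ p ∈ D, Q p.1 p.2 := by
  obtain ⟨t, h0, hmono, -, h, h'⟩ := hD.exists_seq
  have main : ∀ j s, (s, j) ∈ D → Q s j := by
    intro j
    induction j with
    | zero =>
      intro s hs
      have := h 0 s hs
      rw [h0] at this
      exact flow 0 0 s this.1 this.2.2 zero
    | succ j ih =>
      intro s hs
      have h1 := h (j + 1) s hs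
      have h2 : (t (j + 1), j) ∈ D := by
        rw [← mem_slice, h' j (j + 1) s (Nat.lt_succ_self j) hs]
        exact ⟨hmono (Nat.le_succ j), le_rfl⟩
      exact flow _ _ s h1.1 h1.2.2 (jump (t (j + 1), j) ⟨h2, h1.2.1⟩ (ih _ h2))
  exact fun p hp => main p.2 p.1 hp

/-- The only possible jump time out of index j is the common endpoint t (j + 1). -/
theorem IsHybridTimeDomain.measure_jump_eq_zero (hD : IsHybridTimeDomain D) (j : ℕ) :
    volume {s | (s, j) ∈ jumpTimes D} = 0 := by
  obtain ⟨t, -, -, -, h, h'⟩ := hD.exists_seq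
  refine measure_mono_null (t := {t (j + 1)}) (fun s hs => ?_) (by simp)
  have h1 := h (j + 1) s hs.2
  have h2 : s ∈ slice D j := hs.1
  rw [h' j (j + 1) s (Nat.lt_succ_self j) hs.2] at h2
  exact le_antisymm h2.2 h1.1

/-- The left endpoint is excluded because it may be a jump time that also belongs to an earlier
slice; earlier slices end no later than a. -/
theorem IsHybridTimeDomain.firstIndex_eq (hD : IsHybridTimeDomain D) {j : ℕ} {a b s : ℝ}
    (hab : Icc a b ⊆ slice D j) (hs : s ∈ Ioc a b) : firstIndex D s = j := by
  obtain ⟨t, -, hmono, -, h, h'⟩ := hD.exists_seq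
  have hj : (s, j) ∈ D := hab ⟨hs.1.le, hs.2⟩
  have ha : (a, j) ∈ D := hab ⟨le_rfl, hs.1.le.trans hs.2⟩
  refine le_antisymm (Nat.sInf_le hj) (le_csInf ⟨j, hj⟩ fun i hi => ?_)
  by_contra! hlt
  have h1 : s ∈ slice D i := hi
  rw [h' i j s hlt hj] at h1
  exact absurd hs.1 (not_lt.2 (h1.2.trans ((hmono hlt).trans (h j a ha).1)))

theorem IsHybridTimeDomain.Ioc_subset_ordinaryTimes {j : ℕ} {a b : ℝ}
    (hab : Icc a b ⊆ slice D j) : Ioc a b ⊆ ordinaryTimes D :=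
  fun _ hs => ⟨j, hab ⟨hs.1.le, hs.2⟩⟩

end Domain

/-! ### Truncated norms -/

section TruncNorm

variable {U : Type*} [NormedAddCommGroup U] {D : Set (ℝ × ℕ)} {u : ℝ → ℕ → U}

theorem IsHybridTimeDomain.measurableSet_truncated (hD : IsHybridTimeDomain D) (k : ℕ) (T : ℝ) :
    MeasurableSet {s | (s, k) ∈ D \ jumpTimes D ∧ s + k ≤ T} := by
  have : {s | (s, k) ∈ D \ jumpTimes D ∧ s + k ≤ T} =
      (slice D k \ (slice D k ∩ slice D (k + 1))) ∩ Iic (T - k) := by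
    ext s
    simp [jumpTimes, le_sub_iff_add_le]
  rw [this]
  exact ((hD.measurableSet_slice k).diff ((hD.measurableSet_slice k).inter
    (hD.measurableSet_slice (k + 1)))).inter measurableSet_Iic

/-- The essential supremum omits jump times, but these form a null set for each index. -/
theorem IsHybridTimeDomain.ae_enorm_le_truncNorm (hD : IsHybridTimeDomain D) (u : ℝ → ℕ → U)
    (k : ℕ) (T : ℝ) : ∀ᵐ s : ℝ, (s, k) ∈ D → s + k ≤ T → ‖u s k‖ₑ ≤ truncNorm D u T := by
  have h1 := ENNReal.ae_le_essSup (μ := volume.restrict {s | (s, k) ∈ D \ jumpTimes D ∧ s + k ≤ T})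
    (fun s => ‖u s k‖ₑ)
  rw [ae_restrict_iff' (hD.measurableSet_truncated k T)] at h1
  have h2 : ∀ᵐ s : ℝ, (s, k) ∉ jumpTimes D := by
    simpa [ae_iff] using hD.measure_jump_eq_zero k
  filter_upwards [h1, h2] with s hs hj hD' hT
  exact (hs ⟨⟨hD', hj⟩, hT⟩).trans ((le_iSup (fun k : ℕ => essSup (fun s => ‖u s k‖ₑ)
      (volume.restrict {s | (s, k) ∈ D \ jumpTimes D ∧ s + k ≤ T})) k).trans (le_max_left _ _))

theorem enorm_le_truncNorm_of_mem_jumpTimes (u : ℝ → ℕ → U) {T : ℝ} {p : ℝ × ℕ}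
    (hp : p ∈ jumpTimes D) (hT : p.1 + p.2 ≤ T) : ‖u p.1 p.2‖ₑ ≤ truncNorm D u T :=
  (le_iSup₂ (f := fun (p : ℝ × ℕ) (_ : p ∈ {p : ℝ × ℕ | p ∈ jumpTimes D ∧ p.1 + p.2 ≤ T}) =>
    ‖u p.1 p.2‖ₑ) p ⟨hp, hT⟩).trans (le_max_right _ _)

theorem IsHybridTimeDomain.truncNorm_le (hD : IsHybridTimeDomain D) {T : ℝ} {M : ℝ≥0∞}
    (h : ∀ k : ℕ, ∀ᵐ s : ℝ, (s, k) ∈ D → (s, k) ∉ jumpTimes D → s + k ≤ T → ‖u s k‖ₑ ≤ M)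
    (h' : ∀ p ∈ jumpTimes D, p.1 + p.2 ≤ T → ‖u p.1 p.2‖ₑ ≤ M) : truncNorm D u T ≤ M := by
  refine max_le (iSup_le fun k => essSup_le_of_ae_le _ ?_) (iSup₂_le fun p hp => h' p hp.1 hp.2)
  rw [EventuallyLE, ae_restrict_iff' (hD.measurableSet_truncated k T)]
  filter_upwards [h k] with s hs hm
  exact hs hm.1.1 hm.1.2 hm.2

theorem IsZeroInput.truncNorm_eq_zero (hD : IsHybridTimeDomain D) (hu : IsZeroInput D u) (T : ℝ) :
    truncNorm D u T = 0 := by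
  refine le_antisymm (hD.truncNorm_le (fun k => ?_) fun p hp _ => ?_) zero_le
  · refine Eventually.of_forall fun s hs _ _ => ?_
    rw [show u s k = 0 from hu (s, k) hs, enorm_zero]
  · rw [hu p hp.1, enorm_zero]

theorem IsHybridTimeDomain.ae_norm_le_supNorm (hD : IsHybridTimeDomain D)
    (hu : supNorm D u < ∞) (k : ℕ) :
    ∀ᵐ s : ℝ, (s, k) ∈ D → ‖u s k‖ ≤ (supNorm D u).toReal := by
  have h : ∀ᵐ s : ℝ, ∀ n : ℕ, (s, k) ∈ D → s + k ≤ (n : ℝ) →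
      ‖u s k‖ₑ ≤ truncNorm D u n :=
    ae_all_iff.2 fun n => hD.ae_enorm_le_truncNorm u k n
  filter_upwards [h] with s hs hm
  obtain ⟨n, hn⟩ := exists_nat_ge (s + k)
  have := (hs n hm hn).trans (le_iSup (fun T : ℝ => truncNorm D u T) n)
  simpa using ENNReal.toReal_mono hu.ne this

theorem norm_le_supNorm_of_mem_jumpTimes (hu : supNorm D u < ∞) {p : ℝ × ℕ}
    (hp : p ∈ jumpTimes D) : ‖u p.1 p.2‖ ≤ (supNorm D u).toReal := by
  have := (enorm_le_truncNorm_of_mem_jumpTimes u hp le_rfl).trans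
    (le_iSup (fun T : ℝ => truncNorm D u T) _)
  simpa using ENNReal.toReal_mono hu.ne this

end TruncNorm

end SporadicObserver

theorem AbsolutelyContinuousOnInterval.congr {F : Type*} [PseudoMetricSpace F] {f g : ℝ → F}
    {a b : ℝ} (hf : AbsolutelyContinuousOnInterval f a b) (h : EqOn f g (uIcc a b)) :
    AbsolutelyContinuousOnInterval g a b := by
  rw [absolutelyContinuousOnInterval_iff] at hf ⊢
  intro ε hε
  obtain ⟨δ, hδ, H⟩ := hf ε hε
  refine ⟨δ, hδ, fun E hE hlen => ?_⟩
  convert! H E hE hlen using 1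
  exact Finset.sum_congr rfl fun i hi => by rw [h (hE.1 i hi).1, h (hE.1 i hi).2]

/-! ### Extension of inputs by zero and of solutions on a single index -/

namespace SporadicObserver

section ExtendByZero

variable {U : Type*} [NormedAddCommGroup U] {D D' : Set (ℝ × ℕ)} {u : ℝ → ℕ → U}

open scoped Classical in
/-- The hybrid signal that agrees with `u` on `D` and vanishes elsewhere. -/
def extendByZero (D : Set (ℝ × ℕ)) (u : ℝ → ℕ → U) (t : ℝ) (j : ℕ) : U :=
  if (t, j) ∈ D then u t j else 0

theorem extendByZero_of_mem {t : ℝ} {j : ℕ} (h : (t, j) ∈ D) : extendByZero D u t j = u t j :=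
  if_pos h

theorem extendByZero_of_notMem {t : ℝ} {j : ℕ} (h : (t, j) ∉ D) : extendByZero D u t j = 0 :=
  if_neg h

theorem IsZeroInput.extendByZero (hu : IsZeroInput D u) (D' : Set (ℝ × ℕ)) :
    IsZeroInput D' (extendByZero D u) := by
  intro p _
  by_cases h : (p.1, p.2) ∈ D
  · rw [extendByZero_of_mem h]; exact hu p h
  · exact extendByZero_of_notMem h

/-- Local boundedness on D is not enough: the larger domain may contain a compact interval reaching
a right endpoint missing from D. Hence the truncated norm is used as the bound. -/
theorem IsHybridInput.extendByZero (hD : IsHybridTimeDomain D) (hu : IsHybridInput D u)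
    (hb : IsBoundedOnBounded D u) (D' : Set (ℝ × ℕ)) : IsHybridInput D' (extendByZero D u) := by
  intro j
  constructor
  · have h : (fun t => SporadicObserver.extendByZero D u t j) =
        (slice D j).indicator (fun t => u t j) := by
      ext t
      by_cases h : (t, j) ∈ D
      · rw [extendByZero_of_mem h, indicator_of_mem (mem_slice.2 h)]
      · rw [extendByZero_of_notMem h, indicator_of_notMem (mt mem_slice.1 h)]
    rw [h]
    exact ((aestronglyMeasurable_indicator_iff (hD.measurableSet_slice j)).2 (hu j).1).mono_measure
      Measure.restrict_le_self
  · intro a b _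
    refine ⟨(truncNorm D u (b + j)).toReal, ?_⟩
    rw [ae_restrict_iff' measurableSet_Icc]
    filter_upwards [hD.ae_enorm_le_truncNorm u j (b + j)] with t ht hm
    by_cases h : (t, j) ∈ D
    · rw [extendByZero_of_mem h]
      simpa using ENNReal.toReal_mono (hb _).ne (ht h (by linarith [hm.2]))
    · rw [extendByZero_of_notMem h]
      simp

/-- At a new jump time the pointwise value of the input starts to count, whereas an essential
supremum did not see it. Allowing one such point q adds one finite value to the bound. -/
theorem IsBoundedOnBounded.extendByZero (hD : IsHybridTimeDomain D) (hD' : IsHybridTimeDomain D')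
    (hb : IsBoundedOnBounded D u) (q : ℝ × ℕ) (hq : ∀ p ∈ jumpTimes D', p ∉ jumpTimes D → p = q) :
    IsBoundedOnBounded D' (extendByZero D u) := by
  intro T
  refine lt_of_le_of_lt (hD'.truncNorm_le
    (M := max (truncNorm D u T) ‖SporadicObserver.extendByZero D u q.1 q.2‖ₑ)
    (fun k => ?_) fun p hp hT => ?_) (max_lt (hb T) enorm_lt_top)
  · filter_upwards [hD.ae_enorm_le_truncNorm u k T] with s hs _ _ hT
    by_cases h : (s, k) ∈ D
    · rw [extendByZero_of_mem h]
      exact (hs h hT).trans (le_max_left _ _)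
    · rw [extendByZero_of_notMem h]
      simp
  · by_cases h : p ∈ jumpTimes D
    · rw [extendByZero_of_mem h.1]
      exact (enorm_le_truncNorm_of_mem_jumpTimes u h hT).trans (le_max_left _ _)
    · rw [hq p hp h]
      exact le_max_right _ _

end ExtendByZero

variable {X W V : Type*} [NormedAddCommGroup X] [NormedSpace ℝ X]
  [NormedAddCommGroup W] [NormedAddCommGroup V] {H : HybridSystem X W V}
  {D D' : Set (ℝ × ℕ)} {φ φ' : ℝ → ℕ → X} {u : ℝ → ℕ → WithLp 2 (W × V)}

/-- Solutions are only required to be in the flow set at interior times; continuity and closedness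
give the right endpoints, and jumps land in the flow set. -/
theorem IsSolutionPair.mem_flowSet (hs : IsSolutionPair H D φ u) (hcl : IsClosed H.flowSet)
    (hJ : H.jumpSet ⊆ H.flowSet) (hG : ∀ x ∈ H.jumpSet, ∀ η, H.jumpMap x η ⊆ H.flowSet) :
    ∀ p ∈ D, φ p.1 p.2 ∈ H.flowSet := by
  refine hs.domain.induction (Q := fun t j => φ t j ∈ H.flowSet) ?_ ?_ ?_
  · rcases hs.init with h | h
    · rwa [hcl.closure_eq] at h
    · exact hJ h
  · intro j a b hab hI ha
    rcases hab.eq_or_lt with rfl | hlt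
    · exact ha
    · have hc := (hs.arc j a b hab hI).continuousOn
      rw [uIcc_of_le hab] at hc
      have hb : b ∈ closure (Ioo a b) := by
        rw [closure_Ioo hlt.ne]; exact right_mem_Icc.2 hab
      have := ((hc b (right_mem_Icc.2 hab)).mono Ioo_subset_Icc_self).mem_closure hb
        (t := H.flowSet) fun t ht => hs.flow_mem j t
          (interior_maximal (Ioo_subset_Icc_self.trans hI) isOpen_Ioo ht)
      rwa [hcl.closure_eq] at this
  · intro p hp _
    exact hG _ (hs.jump p hp).1 _ (hs.jump p hp).2

/-- A sufficient condition for extending a solution on a single index `m`. -/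
theorem IsSolutionPair.extend (hs : IsSolutionPair H D φ u) (hb : IsBoundedOnBounded D u)
    (hD' : IsHybridTimeDomain D') (hφ : ∀ p ∈ D, φ' p.1 p.2 = φ p.1 p.2) {m : ℕ}
    (hm : ∀ j ≠ m, slice D' j = slice D j)
    (arc : ∀ a b, a ≤ b → Icc a b ⊆ slice D' m →
      AbsolutelyContinuousOnInterval (fun t => φ' t m) a b)
    (mem : ∀ t ∈ interior (slice D' m), φ' t m ∈ H.flowSet)
    (flow : ∀ᵐ t, t ∈ interior (slice D' m) →
      HasDerivAt (fun s => φ' s m) (H.flowMap (φ' t m) (extendByZero D u t m).fst) t)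
    (q : ℝ × ℕ) (jump : ∀ p ∈ jumpTimes D', p ∉ jumpTimes D → p = q ∧ φ' p.1 p.2 ∈ H.jumpSet ∧
      φ' p.1 (p.2 + 1) ∈ H.jumpMap (φ' p.1 p.2) (extendByZero D u p.1 p.2).snd) :
    IsSolutionPair H D' φ' (extendByZero D u) ∧
      IsBoundedOnBounded D' (extendByZero D u) := by
  refine ⟨⟨hD', hs.input.extendByZero hs.domain hb D', fun j a b hab hI => ?_, ?_,
    fun j t ht => ?_, fun j => ?_, fun p hp => ?_⟩,
    hb.extendByZero hs.domain hD' q fun p hp h => (jump p hp h).1⟩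
  · by_cases hj : j = m
    · subst hj; exact arc a b hab hI
    · rw [hm j hj] at hI
      refine (hs.arc j a b hab hI).congr fun t ht => ?_
      rw [uIcc_of_le hab] at ht
      exact (hφ (t, j) (hI ht)).symm
  · rw [hφ (0, 0) hs.domain.zero_mem]
    exact hs.init
  · by_cases hj : j = m
    · subst hj; exact mem t ht
    · rw [hm j hj] at ht
      rw [hφ (t, j) (mem_slice.1 (interior_subset ht))]
      exact hs.flow_mem j t ht
  · by_cases hj : j = m
    · subst hj
      rwa [ae_restrict_iff' isOpen_interior.measurableSet]
    · rw [hm j hj]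
      have h := hs.flow_eq j
      rw [ae_restrict_iff' isOpen_interior.measurableSet] at h ⊢
      filter_upwards [h] with t ht hmem
      have h1 : (t, j) ∈ D := mem_slice.1 (interior_subset hmem)
      rw [extendByZero_of_mem h1, show φ' t j = φ t j from hφ (t, j) h1]
      refine (ht hmem).congr_of_eventuallyEq ?_
      filter_upwards [isOpen_interior.mem_nhds hmem] with s hs'
      exact hφ (s, j) (mem_slice.1 (interior_subset hs'))
  · by_cases h : p ∈ jumpTimes D
    · rw [hφ _ h.1, hφ (p.1, p.2 + 1) h.2, extendByZero_of_mem h.1]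
      exact hs.jump p h
    · exact (jump p hp h).2

end SporadicObserver

/-! ### Continuation of incomplete solutions -/

namespace SporadicObserver

/-- Conditions under which incomplete solutions can be continued: the vector field has linear
growth, and from each point of the flow set one can jump or flow for some time with zero
disturbance. -/
structure CanContinue {X W V : Type*} [NormedAddCommGroup X] [NormedSpace ℝ X]
    [NormedAddCommGroup W] [NormedAddCommGroup V] (H : HybridSystem X W V) : Prop where
  isClosed : IsClosed H.flowSet
  growth : ∃ k : ℝ, 0 ≤ k ∧ ∀ x w, ‖H.flowMap x w‖ ≤ k * (‖x‖ + ‖w‖ + 1)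
  jumpSet_subset : H.jumpSet ⊆ H.flowSet
  jumpMap_subset : ∀ x ∈ H.jumpSet, ∀ η, H.jumpMap x η ⊆ H.flowSet
  continue_from : ∀ x ∈ H.flowSet, (x ∈ H.jumpSet ∧ ∀ η, (H.jumpMap x η).Nonempty) ∨
    ∃ h > 0, ∃ ξ : ℝ → X, ξ 0 = x ∧ (∃ K, LipschitzOnWith K ξ (Icc 0 h)) ∧
      ∀ t ∈ Ioo 0 h, HasDerivAt ξ (H.flowMap (ξ t) 0) t ∧ ξ t ∈ H.flowSet

variable {X W V : Type*} [NormedAddCommGroup X] [InnerProductSpace ℝ X] [FiniteDimensional ℝ X]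
  [NormedAddCommGroup W] [NormedAddCommGroup V] {H : HybridSystem X W V}
  {D : Set (ℝ × ℕ)} {φ : ℝ → ℕ → X} {u : ℝ → ℕ → WithLp 2 (W × V)}

/-- On a half-open interval of finite length, a solution with bounded input is Lipschitz. -/
theorem IsSolutionPair.exists_lipschitzOnWith (hs : IsSolutionPair H D φ u)
    (hb : IsBoundedOnBounded D u)
    (hgr : ∃ k : ℝ, 0 ≤ k ∧ ∀ x w, ‖H.flowMap x w‖ ≤ k * (‖x‖ + ‖w‖ + 1)) {J : ℕ} {a T : ℝ}
    (hI : slice D J = Ico a T) :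
    ∃ K, LipschitzOnWith K (fun t => φ t J) (Ico a T) := by
  obtain ⟨k, hk, hgr⟩ := hgr
  set M := (truncNorm D u (T + J)).toReal with hM
  have hM0 : 0 ≤ M := ENNReal.toReal_nonneg
  have hsub : ∀ {b c}, a ≤ b → c < T → Icc b c ⊆ slice D J := fun hab hcT => by
    rw [hI]; exact fun t ht => ⟨hab.trans ht.1, ht.2.trans_lt hcT⟩
  have hder : ∀ᵐ t, t ∈ Ioo a T →
      HasDerivAt (fun s => φ s J) (H.flowMap (φ t J) (u t J).fst) t ∧ ‖(u t J).fst‖ ≤ M := by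
    have h := hs.flow_eq J
    rw [ae_restrict_iff' isOpen_interior.measurableSet, hI, interior_Ico] at h
    filter_upwards [h, hs.domain.ae_enorm_le_truncNorm u J (T + J)] with t h1 h2 ht
    refine ⟨h1 ht, (WithLp.norm_fst_le _ _).trans ?_⟩
    have h3 : t ∈ slice D J := by rw [hI]; exact ⟨ht.1.le, ht.2⟩
    simpa using ENNReal.toReal_mono (hb _).ne (h2 h3 (by linarith [ht.2]))
  -- The Grönwall bound with rate constant k(M + 1), as k(‖x‖ + M + 1) ≤ k(M + 1)(‖x‖ + 1); it
  -- bounds ‖x‖² + 1, which dominates ‖x‖.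
  set R := Real.exp (4 * (k * (M + 1)) * (T - a)) * (‖φ a J‖ ^ 2 + 1) with hR
  have hbd : ∀ t ∈ Ico a T, ‖φ t J‖ ≤ R := by
    intro t ht
    have hac := hs.arc J a t ht.1 (hsub le_rfl ht.2)
    have := hac.norm_sq_add_one_le (f' := fun t => H.flowMap (φ t J) (u t J).fst)
      (k := k * (M + 1)) ht.1 (by positivity) ?_
    · have h2 : Real.exp (4 * (k * (M + 1)) * (t - a)) ≤
          Real.exp (4 * (k * (M + 1)) * (T - a)) :=
        Real.exp_le_exp.2 (mul_le_mul_of_nonneg_left (by linarith [ht.2]) (by positivity))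
      have h3 := mul_le_mul_of_nonneg_right h2 (by positivity : 0 ≤ ‖φ a J‖ ^ 2 + 1)
      nlinarith [sq_nonneg (‖φ t J‖ - 1)]
    · filter_upwards [hder] with s h1 hs'
      obtain ⟨h2, h3⟩ := h1 ⟨hs'.1, hs'.2.trans ht.2⟩
      refine ⟨h2, (hgr _ _).trans ?_⟩
      rw [mul_assoc]
      refine mul_le_mul_of_nonneg_left ?_ hk
      nlinarith [norm_nonneg (φ s J)]
  have hL0 : 0 ≤ k * (R + M + 1) := by positivity
  have hdist : ∀ b c, a ≤ b → b ≤ c → c < T → ‖φ c J - φ b J‖ ≤ k * (R + M + 1) * (c - b) := by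
    intro b c hab hbc hcT
    refine (hs.arc J b c hbc (hsub hab hcT)).norm_sub_le_of_ae_norm_deriv_le
      (f' := fun t => H.flowMap (φ t J) (u t J).fst) hbc ?_
    filter_upwards [hder] with s h1 hs'
    obtain ⟨h2, h3⟩ := h1 ⟨hab.trans_lt hs'.1, hs'.2.trans hcT⟩
    refine ⟨h2, (hgr _ _).trans (mul_le_mul_of_nonneg_left ?_ hk)⟩
    linarith [hbd s ⟨hab.trans hs'.1.le, hs'.2.trans hcT⟩]
  refine ⟨(k * (R + M + 1)).toNNReal, LipschitzOnWith.of_dist_le_mul fun x hx y hy => ?_⟩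
  rw [dist_eq_norm, Real.dist_eq, Real.coe_toNNReal _ hL0]
  rcases le_total x y with h | h
  · rw [norm_sub_rev, abs_sub_comm, abs_of_nonneg (sub_nonneg.2 h)]
    exact hdist x y hx.1 h hy.2
  · rw [abs_of_nonneg (sub_nonneg.2 h)]
    exact hdist y x hy.1 h hx.2

open scoped Classical in
/-- An incomplete solution with bounded input has a proper extension with input vanishing on the
new part of the domain. -/
theorem CanContinue.exists_extension (hH : CanContinue H) (hs : IsSolutionPair H D φ u)
    (hb : IsBoundedOnBounded D u) {r : ℝ} (hr : ∀ p ∈ D, p.1 + p.2 < r) :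
    ∃ D' φ', D ⊆ D' ∧ D' ≠ D ∧ (∀ p ∈ D, φ' p.1 p.2 = φ p.1 p.2) ∧
      IsSolutionPair H D' φ' (extendByZero D u) ∧ IsBoundedOnBounded D' (extendByZero D u) := by
  have hmemF := hs.mem_flowSet hH.isClosed hH.jumpSet_subset hH.jumpMap_subset
  obtain ⟨t, h0, hmono, hinf | ⟨J, h1, h2, h3⟩⟩ := hs.domain
  · obtain ⟨n, hn⟩ := exists_nat_ge r
    have h4 : (t n, n) ∈ D := by
      rw [← mem_slice, hinf]; exact ⟨le_rfl, hmono (Nat.le_succ n)⟩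
    have := hr _ h4
    have h5 : 0 ≤ t n := h0 ▸ hmono (Nat.zero_le n)
    simp only at this
    linarith
  have hDne : ∀ {D' : Set (ℝ × ℕ)} {p : ℝ × ℕ}, p ∈ D' → p ∉ D → D' ≠ D := by
    rintro D' p h h' rfl; exact h' h
  have hpast : ∀ {s j}, j < J → (s, j) ∈ D → s ≤ t J := fun {s j} hj hsj => by
    rw [← mem_slice, h1 j hj] at hsj; exact hsj.2.trans (hmono hj)
  have hle : ∀ {s j}, (s, j) ∈ D → j ≤ J := fun {s j} hsj => by
    by_contra hlt
    rw [← mem_slice, h2 j (not_le.1 hlt)] at hsj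
    exact hsj
  -- Common part of flowing on and of closing a half-open interval: the last slice becomes [t J, T']
  -- and ξ fills in the times outside D. No jump time is created, so the exceptional point passed to
  -- `IsSolutionPair.extend` is arbitrary.
  have prolong : ∀ T' (ξ : ℝ → X), t J < T' → (t J, J) ∈ D → (T', J) ∉ D →
      slice D J ⊆ Icc (t J) T' →
      AbsolutelyContinuousOnInterval (fun s => if (s, J) ∈ D then φ s J else ξ s) (t J) T' →
      (∀ s ∈ Ioo (t J) T', (s, J) ∉ D → ξ s ∈ H.flowSet) →
      (∀ᵐ s, s ∈ Ioo (t J) T' → HasDerivAt (fun s => if (s, J) ∈ D then φ s J else ξ s)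
        (H.flowMap (if (s, J) ∈ D then φ s J else ξ s) (extendByZero D u s J).fst) s) →
      ∃ D' φ', D ⊆ D' ∧ D' ≠ D ∧ (∀ p ∈ D, φ' p.1 p.2 = φ p.1 p.2) ∧
        IsSolutionPair H D' φ' (extendByZero D u) ∧
        IsBoundedOnBounded D' (extendByZero D u) := by
    intro T' ξ hT' htJ hT'D hsub hac hfm hfe
    have hsl : ∀ j ≠ J, slice (D ∪ Icc (t J) T' ×ˢ {J}) j = slice D j := by
      intro j hj; ext s; simp [hj]
    have hsl' : slice (D ∪ Icc (t J) T' ×ˢ {J}) J = Icc (t J) T' := by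
      ext s
      simp only [mem_slice, mem_union, mem_prod, mem_singleton_iff, and_true,
        or_iff_right_iff_imp]
      exact fun hmem => hsub hmem
    have hφ : ∀ p ∈ D, (fun s j => if (s, j) ∈ D then φ s j else ξ s) p.1 p.2 = φ p.1 p.2 :=
      fun p hp => if_pos hp
    refine ⟨D ∪ Icc (t J) T' ×ˢ {J}, fun s j => if (s, j) ∈ D then φ s j else ξ s,
      subset_union_left, hDne (Or.inr ⟨right_mem_Icc.2 hT'.le, rfl⟩) hT'D, hφ,
      hs.extend hb ?_ hφ hsl ?_ ?_ ?_ (0, 0) ?_⟩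
    · exact ⟨t, h0, hmono, Or.inr ⟨J, fun j hj => by rw [hsl j hj.ne, h1 j hj],
        fun j hj => by rw [hsl j hj.ne', h2 j hj], Or.inl ⟨T', hT'.le, hsl'⟩⟩⟩
    · intro a b hab hI
      rw [hsl'] at hI
      exact hac.mono (by rwa [uIcc_of_le hab, uIcc_of_le hT'.le])
    · intro s hs'
      rw [hsl', interior_Icc] at hs'
      by_cases hsD : (s, J) ∈ D
      · simpa only [if_pos hsD] using hmemF _ hsD
      · simpa only [if_neg hsD] using hfm s hs' hsD
    · rw [hsl', interior_Icc]
      exact hfe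
    · rintro ⟨s, j⟩ ⟨hp1, hp2⟩ hp
      refine absurd ⟨?_, ?_⟩ hp
      · rcases hp1 with hp1 | ⟨-, hp1⟩
        · exact hp1
        · obtain rfl : j = J := hp1
          rcases hp2 with hp2 | ⟨-, hp2⟩
          · exact absurd (hle hp2) (by simp)
          · simp at hp2
      · rcases hp2 with hp2 | ⟨hp3, hp2⟩
        · exact hp2
        · obtain rfl : j + 1 = J := hp2
          have hj : (s, j) ∈ D := by
            rcases hp1 with hp1 | ⟨-, hp1⟩
            · exact hp1
            · simp at hp1
          rwa [show s = t (j + 1) from le_antisymm (hpast (Nat.lt_succ_self j) hj) hp3.1]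
  rcases h3 with ⟨T, hT, h3⟩ | ⟨T, hT, h3⟩ | h3
  · have hTD : (T, J) ∈ D := by rw [← mem_slice, h3]; exact ⟨hT, le_rfl⟩
    rcases hH.continue_from _ (hmemF _ hTD) with ⟨hj, hne⟩ | ⟨h, hh, ξ, hξ0, ⟨K, hK⟩, hξ⟩
    · -- a jump
      obtain ⟨g, hg⟩ := hne (u T J).snd
      have hnD : (T, J + 1) ∉ D := fun hmem => absurd (hle hmem) (by simp)
      set φ' : ℝ → ℕ → X := fun s j => if (s, j) ∈ D then φ s j else g with hφ'
      have hφ : ∀ p ∈ D, φ' p.1 p.2 = φ p.1 p.2 := fun p hp => if_pos hp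
      have hsl : ∀ j ≠ J + 1, slice (insert (T, J + 1) D) j = slice D j := by
        intro j hj; ext s; simp [hj]
      have hsl' : slice (insert (T, J + 1) D) (J + 1) = {T} := by
        ext s
        simp only [mem_slice, mem_insert_iff, Prod.mk.injEq, and_true, mem_singleton_iff,
          or_iff_left_iff_imp]
        exact fun hmem => absurd (hle hmem) (by simp)
      refine ⟨insert (T, J + 1) D, φ', subset_insert _ _, hDne (mem_insert _ _) hnD, hφ,
        hs.extend hb ?_ hφ hsl ?_ ?_ ?_ (T, J) ?_⟩
      -- After the jump the new slice is the single point T, so the sequence of jump times is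
      -- constant from J + 1 on.
      · refine ⟨fun j => if j ≤ J then t j else T, by simp [h0], ?_,
          Or.inr ⟨J + 1, ?_, ?_, Or.inl ⟨T, by simp, by simp [hsl']⟩⟩⟩
        · intro i j hij
          dsimp only
          split_ifs with h4 h5 h5
          · exact hmono hij
          · exact (hmono h4).trans hT
          · omega
          · exact le_rfl
        · intro j hj
          rw [hsl j hj.ne]
          rcases (Nat.lt_succ_iff.1 hj).eq_or_lt with rfl | hlt
          · simp [h3]
          · simp [h1 j hlt, hlt.le, Nat.succ_le_iff.2 hlt]
        · intro j hj
          rw [hsl j hj.ne']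
          exact h2 j (by omega)
      · intro a b hab hI
        rw [hsl'] at hI
        have ha : a = T := hI (left_mem_Icc.2 hab)
        have hb' : b = T := hI (right_mem_Icc.2 hab)
        rw [ha, hb']
        exact LipschitzOnWith.absolutelyContinuousOnInterval (K := 0) (by simp)
      · simp [hsl']
      · simp [hsl']
      · rintro ⟨s, j⟩ ⟨hp1, hp2⟩ hp
        have h4 : s = T ∧ j = J := by
          rcases hp2 with heq | hp2
          · simpa using heq
          · rcases hp1 with heq | hp1
            · simp only [Prod.mk.injEq] at heq
              have := hle hp2
              omega
            · exact absurd ⟨hp1, hp2⟩ hp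
        obtain ⟨rfl, rfl⟩ := h4
        refine ⟨rfl, ?_, ?_⟩
        · rw [hφ _ hTD]; exact hj
        · simp only [extendByZero_of_mem hTD, hφ']
          rwa [if_pos hTD, if_neg hnD]
    · -- flowing on
      have hJD : ∀ {s}, (s, J) ∈ D ↔ s ∈ Icc (t J) T := fun {s} => by rw [← mem_slice, h3]
      refine prolong (T + h) (fun s => ξ (s - T)) (by linarith) (hJD.2 ⟨le_rfl, hT⟩)
        (fun hmem => by linarith [(hJD.1 hmem).2])
        (fun s hs' => ⟨(hJD.1 hs').1, (hJD.1 hs').2.trans (by linarith)⟩) ?_ ?_ ?_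
      -- The glued function is φ(min s T) + ξ(max s T - T) - φ(T), a combination of absolutely
      -- continuous functions on the whole interval.
      · have hac1 := (hs.arc J (t J) T hT h3.ge).comp_min (b := T + h) (by linarith) hT
        have hac2 : AbsolutelyContinuousOnInterval (fun s => ξ (max s T - T)) (t J) (T + h) := by
          refine LipschitzOnWith.absolutelyContinuousOnInterval (K := K)
            (LipschitzOnWith.of_dist_le_mul fun x hx y hy => ?_)
          rw [uIcc_of_le (by linarith)] at hx hy
          refine (hK.dist_le_mul (max x T - T) ⟨by simp, by simp [hx.2, hh.le, add_comm h]⟩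
            (max y T - T) ⟨by simp, by simp [hy.2, hh.le, add_comm h]⟩).trans
            (mul_le_mul_of_nonneg_left ?_ K.2)
          simp only [Real.dist_eq, sub_sub_sub_cancel_right]
          simpa using abs_max_sub_max_le_max x T y T
        have hac3 : AbsolutelyContinuousOnInterval (fun _ => φ T J) (t J) (T + h) :=
          LipschitzOnWith.absolutelyContinuousOnInterval (K := 0)
            (LipschitzWith.const _).lipschitzOnWith
        refine ((hac1.fun_add hac2).fun_sub hac3).congr fun s hs' => ?_
        rw [uIcc_of_le (by linarith)] at hs'
        dsimp only
        by_cases hsT : s ≤ T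
        · rw [if_pos (hJD.2 ⟨hs'.1, hsT⟩), min_eq_left hsT, max_eq_right hsT, sub_self, hξ0]
          simp
        · rw [if_neg (fun hmem => hsT (hJD.1 hmem).2), min_eq_right (le_of_not_ge hsT),
            max_eq_left (le_of_not_ge hsT)]
          abel
      · intro s hs' hsD
        have : T < s := by
          by_contra! hlt
          exact hsD (hJD.2 ⟨hs'.1.le, hlt⟩)
        exact (hξ (s - T) ⟨by linarith, by linarith [hs'.2]⟩).2
      · have hfe := hs.flow_eq J
        rw [ae_restrict_iff' isOpen_interior.measurableSet, h3, interior_Icc] at hfe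
        have hne : ∀ᵐ s : ℝ, s ≠ T := by simp [ae_iff]
        filter_upwards [hfe, hne] with s hf hsT hs'
        rcases lt_or_gt_of_ne hsT with hlt | hlt
        · have hsD : (s, J) ∈ D := hJD.2 ⟨hs'.1.le, hlt.le⟩
          rw [if_pos hsD, extendByZero_of_mem hsD]
          refine (hf ⟨hs'.1, hlt⟩).congr_of_eventuallyEq ?_
          filter_upwards [Ioo_mem_nhds hs'.1 hlt] with s' h'
          exact if_pos (hJD.2 ⟨h'.1.le, h'.2.le⟩)
        · have hsD : ∀ {s'}, T < s' → (s', J) ∉ D :=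
            fun h' hmem => absurd (hJD.1 hmem).2 (not_le.2 h')
          rw [if_neg (hsD hlt), extendByZero_of_notMem (hsD hlt)]
          have hd := ((hξ (s - T) ⟨by linarith, by linarith [hs'.2]⟩).1).comp_sub_const s T
          refine HasDerivAt.congr_of_eventuallyEq hd ?_
          filter_upwards [Ioi_mem_nhds hlt] with s' h'
          exact if_neg (hsD h')
  · -- closing a half-open interval
    have hJD : ∀ {s}, (s, J) ∈ D ↔ s ∈ Ico (t J) T := fun {s} => by rw [← mem_slice, h3]
    -- Being Lipschitz on the half-open interval, the solution has a Lipschitz extension, whose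
    -- value at T closes the interval.
    obtain ⟨K, hK⟩ := hs.exists_lipschitzOnWith hb hH.growth h3
    obtain ⟨g, hg, hgφ⟩ := hK.extend_finite_dimension
    refine prolong T g hT (hJD.2 ⟨le_rfl, hT⟩) (fun hmem => lt_irrefl _ (hJD.1 hmem).2)
      (fun s hs' => ⟨(hJD.1 hs').1, (hJD.1 hs').2.le⟩) ?_ ?_ ?_
    · refine (hg.lipschitzOnWith.absolutelyContinuousOnInterval).congr fun s _ => ?_
      split_ifs with hsD
      · exact (hgφ (hJD.1 hsD)).symm
      · rfl
    · exact fun s hs' hsD => absurd (hJD.2 ⟨hs'.1.le, hs'.2⟩) hsD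
    · have hfe := hs.flow_eq J
      rw [ae_restrict_iff' isOpen_interior.measurableSet, h3, interior_Ico] at hfe
      filter_upwards [hfe] with s hf hs'
      have hsD : (s, J) ∈ D := hJD.2 ⟨hs'.1.le, hs'.2⟩
      rw [if_pos hsD, extendByZero_of_mem hsD]
      refine (hf hs').congr_of_eventuallyEq ?_
      filter_upwards [Ioo_mem_nhds hs'.1 hs'.2] with s' h'
      exact if_pos (hJD.2 ⟨h'.1.le, h'.2⟩)
  · have hm : (max (t J) r, J) ∈ D := by rw [← mem_slice, h3]; exact mem_Ici.2 (le_max_left _ _)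
    have := hr _ hm
    have h4 := le_max_right (t J) r
    have h5 : (0 : ℝ) ≤ J := Nat.cast_nonneg J
    simp only at this
    linarith

theorem CanContinue.maximalAreComplete_isBoundedOnBounded (hH : CanContinue H) :
    MaximalAreComplete H IsBoundedOnBounded := by
  intro D φ u hs hb hmax r
  by_contra! hr
  obtain ⟨D', φ', hsub, hne, hφ, hs', hb'⟩ := hH.exists_extension hs hb hr
  exact hne (hmax D' φ' _ hs' hb' hsub fun p hp => ⟨hφ p hp, extendByZero_of_mem hp⟩)

theorem CanContinue.maximalAreComplete_isZeroInput (hH : CanContinue H) :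
    MaximalAreComplete H IsZeroInput := by
  intro D φ u hs hz hmax r
  by_contra! hr
  have hb : IsBoundedOnBounded D u := fun T => by
    rw [hz.truncNorm_eq_zero hs.domain]
    exact ENNReal.zero_lt_top
  obtain ⟨D', φ', hsub, hne, hφ, hs', -⟩ := hH.exists_extension hs hb hr
  exact hne (hmax D' φ' _ hs' (hz.extendByZero D') hsub
    fun p hp => ⟨hφ p hp, extendByZero_of_mem hp⟩)

end SporadicObserver

/-! ### The matrix inequalities and the dissipation inequality -/

namespace SporadicObserver

section LMI

open Matrix

theorem dotProduct_mulVec_transpose_comm {m n : Type*} [Fintype m] [Fintype n] (M : Matrix m n ℝ)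
    (x : n → ℝ) (y : m → ℝ) : x ⬝ᵥ (Mᵀ *ᵥ y) = y ⬝ᵥ (M *ᵥ x) := by
  rw [mulVec_transpose, dotProduct_comm, dotProduct_mulVec]

variable {nz ny nw nq ns np : ℕ} (pl : Plant nz ny nw nq ns np) (lam γ δ χ e : ℝ)
  (P₁ : Matrix (Fin nz) (Fin nz) ℝ) (P₂ : Matrix (Fin ny) (Fin ny) ℝ)
  (X : Matrix (Fin nz) (Fin nz) ℝ) (U W : Matrix (Fin ny) (Fin ny) ℝ)
  (J : Matrix (Fin nz) (Fin ny) ℝ)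

/-- The quadratic form of `lmiMatrix`. The terms with a factor `2` in the last two lines vanish
along the flow. -/
theorem lmiMatrix_quadForm (a c : Fin nz → ℝ) (b d : Fin ny → ℝ) (w : Fin nw → ℝ)
    (ζ : Fin ns → ℝ) :
    Sum.elim (Sum.elim (Sum.elim a b) (Sum.elim c d)) (Sum.elim w ζ) ⬝ᵥ
      (lmiMatrix pl lam γ δ χ e P₁ P₂ X U W J *ᵥ
        Sum.elim (Sum.elim (Sum.elim a b) (Sum.elim c d)) (Sum.elim w ζ)) =
    2 * (a ⬝ᵥ (P₁ *ᵥ c)) + 2 * e * (b ⬝ᵥ (P₂ *ᵥ d)) + 2 * lam * (c ⬝ᵥ (P₁ *ᵥ c))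
      + (pl.Cp *ᵥ c) ⬝ᵥ (pl.Cp *ᵥ c) + χ * pl.ℓ ^ 2 * ((pl.S *ᵥ c) ⬝ᵥ (pl.S *ᵥ c))
      + (2 * lam - δ) * e * (d ⬝ᵥ (P₂ *ᵥ d)) - γ ^ 2 * (w ⬝ᵥ w) - χ * (ζ ⬝ᵥ ζ)
      + 2 * ((pl.A *ᵥ c + pl.B *ᵥ ζ + pl.N *ᵥ w - a) ⬝ᵥ (X *ᵥ (a + c))
        + (a + c) ⬝ᵥ (J *ᵥ (d - pl.C *ᵥ c)))
      + 2 * ((U *ᵥ (b + d)) ⬝ᵥ (pl.C *ᵥ a) - b ⬝ᵥ (U *ᵥ (b + d))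
        + (b + d) ⬝ᵥ (W *ᵥ (d - pl.C *ᵥ c))) := by
  simp only [lmiMatrix, He, fromBlocks_mulVec, Sum.elim_comp_inl, Sum.elim_comp_inr,
    fromBlocks_transpose, transpose_fromRows, fromRows_mulVec, fromCols_mulVec,
    sumElim_dotProduct_sumElim, add_mulVec, transpose_add, transpose_mul, transpose_neg,
    transpose_sub, transpose_transpose, transpose_smul, transpose_zero, neg_mulVec,
    sub_mulVec, smul_mulVec, zero_mulVec, one_mulVec, ← mulVec_mulVec, dotProduct_add,
    dotProduct_sub, dotProduct_neg, dotProduct_smul, mulVec_add, mulVec_sub,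
    add_dotProduct, sub_dotProduct,
    dotProduct_mulVec_transpose_comm, smul_eq_mul, add_zero, zero_add, ← Sum.elim_add_add]
  simp only [dotProduct_comm (X *ᵥ a) (pl.A *ᵥ c), dotProduct_comm (X *ᵥ c) (pl.A *ᵥ c),
    dotProduct_comm (X *ᵥ a) (pl.N *ᵥ w), dotProduct_comm (X *ᵥ c) (pl.N *ᵥ w),
    dotProduct_comm (X *ᵥ a) (pl.B *ᵥ ζ), dotProduct_comm (X *ᵥ c) (pl.B *ᵥ ζ),
    dotProduct_comm (pl.C *ᵥ a) (U *ᵥ b), dotProduct_comm (pl.C *ᵥ a) (U *ᵥ d),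
    dotProduct_comm (Jᵀ *ᵥ a) (pl.C *ᵥ c), dotProduct_comm (Jᵀ *ᵥ c) (pl.C *ᵥ c),
    dotProduct_comm (Wᵀ *ᵥ b) (pl.C *ᵥ c), dotProduct_comm (Wᵀ *ᵥ d) (pl.C *ᵥ c),
    dotProduct_mulVec_transpose_comm]
  ring

variable {pl lam γ δ χ P₁ P₂ X U W J} {T₂ : ℝ}

theorem NegDef.dotProduct_mulVec_neg {ι : Type*} [Fintype ι] {M : Matrix ι ι ℝ} (h : NegDef M)
    {v : ι → ℝ} (hv : v ≠ 0) : v ⬝ᵥ (M *ᵥ v) < 0 := by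
  have := PosDef.dotProduct_mulVec_pos h hv
  simpa [neg_mulVec] using this

theorem NegDef.dotProduct_mulVec_nonpos {ι : Type*} [Fintype ι] {M : Matrix ι ι ℝ}
    (h : NegDef M) (v : ι → ℝ) : v ⬝ᵥ (M *ᵥ v) ≤ 0 := by
  rcases eq_or_ne v 0 with rfl | hv
  · simp
  · exact (h.dotProduct_mulVec_neg hv).le

theorem isUnit_det_of_mulVec_eq_zero {n : ℕ} {M : Matrix (Fin n) (Fin n) ℝ}
    (h : ∀ v, M *ᵥ v = 0 → v = 0) : IsUnit M.det := by
  rw [isUnit_iff_ne_zero]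
  intro h0
  obtain ⟨v, hv, hMv⟩ := exists_mulVec_eq_zero_iff.2 h0
  exact hv (h v hMv)

/-- A kernel vector of X placed in the slot of ε' makes the whole quadratic form vanish, against
strict negativity. The slot of θ̃' plays this role for U. -/
theorem LMIsFeasibleAt.isUnit_det_X (h : LMIsFeasibleAt pl T₂ lam γ δ χ P₁ P₂ X U W J) :
    IsUnit X.det := by
  refine isUnit_det_of_mulVec_eq_zero fun v hv => ?_
  by_contra hne
  have h1 := h.lmi_zero.dotProduct_mulVec_neg
    (v := Sum.elim (Sum.elim (Sum.elim v 0) (Sum.elim 0 0)) (Sum.elim 0 0)) fun h0 =>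
      hne (funext fun i => by simpa using congrFun h0 (Sum.inl (Sum.inl (Sum.inl i))))
  rw [lmiMatrix_quadForm] at h1
  simp [hv] at h1

theorem LMIsFeasibleAt.isUnit_det_U (h : LMIsFeasibleAt pl T₂ lam γ δ χ P₁ P₂ X U W J) :
    IsUnit U.det := by
  refine isUnit_det_of_mulVec_eq_zero fun v hv => ?_
  by_contra hne
  have h1 := h.lmi_zero.dotProduct_mulVec_neg
    (v := Sum.elim (Sum.elim (Sum.elim 0 v) (Sum.elim 0 0)) (Sum.elim 0 0)) fun h0 =>
      hne (funext fun i => by simpa using congrFun h0 (Sum.inl (Sum.inl (Sum.inr i))))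
  rw [lmiMatrix_quadForm] at h1
  simp [hv] at h1

/-- Since the quadratic form is affine in `e`, the two matrix inequalities yield one for each `e`
between `1` and `exp (δ T₂)`. -/
theorem LMIsFeasibleAt.quadForm_nonpos (h : LMIsFeasibleAt pl T₂ lam γ δ χ P₁ P₂ X U W J)
    {e : ℝ} (he : e ∈ Icc 1 (Real.exp (δ * T₂))) (a c : Fin nz → ℝ) (b d : Fin ny → ℝ)
    (w : Fin nw → ℝ) (ζ : Fin ns → ℝ) :
    Sum.elim (Sum.elim (Sum.elim a b) (Sum.elim c d)) (Sum.elim w ζ) ⬝ᵥ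
      (lmiMatrix pl lam γ δ χ e P₁ P₂ X U W J *ᵥ
        Sum.elim (Sum.elim (Sum.elim a b) (Sum.elim c d)) (Sum.elim w ζ)) ≤ 0 := by
  have h0 := h.lmi_zero.dotProduct_mulVec_nonpos
    (Sum.elim (Sum.elim (Sum.elim a b) (Sum.elim c d)) (Sum.elim w ζ))
  have h1 := h.lmi_T₂.dotProduct_mulVec_nonpos
    (Sum.elim (Sum.elim (Sum.elim a b) (Sum.elim c d)) (Sum.elim w ζ))
  rw [lmiMatrix_quadForm] at h0 h1 ⊢
  set E := Real.exp (δ * T₂)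
  rcases he.1.eq_or_lt with rfl | hlt
  · exact h0
  have hE : 0 < E - 1 := by linarith [he.2]
  -- With Q the form as a function of e: (E - 1) Q(e) = (E - e) Q(1) + (e - 1) Q(E).
  refine nonpos_of_mul_nonpos_right (a := E - 1) ?_ hE
  have h2 := mul_nonpos_of_nonneg_of_nonpos (sub_nonneg.2 he.2) h0
  have h3 := mul_nonpos_of_nonneg_of_nonpos (sub_nonneg.2 he.1) h1
  linarith

theorem ofLp_app {m n : ℕ} (M : Matrix (Fin m) (Fin n) ℝ) (v : E n) :
    (app M v).ofLp = M *ᵥ v.ofLp := rfl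

theorem E_inner_eq {n : ℕ} (x y : E n) : inner ℝ x y = x.ofLp ⬝ᵥ y.ofLp := by
  rw [EuclideanSpace.inner_eq_star_dotProduct, star_trivial, dotProduct_comm]

theorem E_norm_sq_eq {n : ℕ} (x : E n) : ‖x‖ ^ 2 = x.ofLp ⬝ᵥ x.ofLp := by
  rw [← real_inner_self_eq_norm_sq, E_inner_eq]

theorem inner_app_comm {n : ℕ} {P : Matrix (Fin n) (Fin n) ℝ} (hP : P.PosDef) (x y : E n) :
    inner ℝ x (app P y) = inner ℝ y (app P x) := by
  rw [E_inner_eq, E_inner_eq, ofLp_app, ofLp_app, ← dotProduct_mulVec_transpose_comm]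
  congr 2
  have := hP.isHermitian
  rwa [IsHermitian, conjTranspose_eq_transpose_of_trivial] at this

/-- The dissipation inequality behind the matrix inequalities. -/
theorem LMIsFeasibleAt.dissipation (h : LMIsFeasibleAt pl T₂ lam γ δ χ P₁ P₂ X U W J)
    {e : ℝ} (he : e ∈ Icc 1 (Real.exp (δ * T₂)))
    {L : Matrix (Fin nz) (Fin ny) ℝ} {H : Matrix (Fin ny) (Fin ny) ℝ} (hL : J = Xᵀ * L)
    (hH : W = Uᵀ * H) {ε : E nz} {θ : E ny} {w : E nw} {ζ : E ns}
    (hζ : ‖ζ‖ ≤ pl.ℓ * ‖app pl.S ε‖) {ε' : E nz}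
    (hε' : ε' = app pl.A ε + app pl.B ζ + app pl.N w - app L θ) :
    2 * inner ℝ ε' (app P₁ ε)
      + 2 * e * inner ℝ (app pl.C ε' - app H θ) (app P₂ (app pl.C ε - θ))
      - δ * e * inner ℝ (app pl.C ε - θ) (app P₂ (app pl.C ε - θ)) ≤
    -(2 * lam) * (inner ℝ ε (app P₁ ε)
      + e * inner ℝ (app pl.C ε - θ) (app P₂ (app pl.C ε - θ)))
      - ‖app pl.Cp ε‖ ^ 2 + γ ^ 2 * ‖w‖ ^ 2 := by
  set b := app pl.C ε' - app H θ with hb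
  set d := app pl.C ε - θ with hd
  have h1 := h.quadForm_nonpos he ε'.ofLp ε.ofLp b.ofLp d.ofLp w.ofLp ζ.ofLp
  rw [lmiMatrix_quadForm] at h1
  -- The Lipschitz bound makes the χ-terms of the form nonnegative, so they can be dropped.
  have hζ' : χ * ‖ζ‖ ^ 2 ≤ χ * pl.ℓ ^ 2 * ‖app pl.S ε‖ ^ 2 := by
    rw [mul_assoc, ← mul_pow]
    exact mul_le_mul_of_nonneg_left (pow_le_pow_left₀ (norm_nonneg _) hζ 2) h.χ_pos.le
  -- The multiplier terms vanish: both factors reduce to θ, and J = XᵀL makes the two summands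
  -- cancel; below, W = UᵀH does the same for U.
  have e1 : (pl.A *ᵥ ε.ofLp + pl.B *ᵥ ζ.ofLp + pl.N *ᵥ w.ofLp - ε'.ofLp) ⬝ᵥ
      (X *ᵥ (ε'.ofLp + ε.ofLp))
        + (ε'.ofLp + ε.ofLp) ⬝ᵥ (J *ᵥ (d.ofLp - pl.C *ᵥ ε.ofLp)) = 0 := by
    have i1 : pl.A *ᵥ ε.ofLp + pl.B *ᵥ ζ.ofLp + pl.N *ᵥ w.ofLp - ε'.ofLp = L *ᵥ θ.ofLp := by
      rw [hε']; simp
    have i2 : d.ofLp - pl.C *ᵥ ε.ofLp = -θ.ofLp := by simp [hd]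
    rw [i1, i2, hL, mulVec_neg, dotProduct_neg, ← mulVec_mulVec, dotProduct_mulVec_transpose_comm,
      add_neg_cancel]
  have e2 : (U *ᵥ (b.ofLp + d.ofLp)) ⬝ᵥ (pl.C *ᵥ ε'.ofLp) - b.ofLp ⬝ᵥ (U *ᵥ (b.ofLp + d.ofLp))
        + (b.ofLp + d.ofLp) ⬝ᵥ (W *ᵥ (d.ofLp - pl.C *ᵥ ε.ofLp)) = 0 := by
    have i1 : pl.C *ᵥ ε'.ofLp = b.ofLp + H *ᵥ θ.ofLp := by simp [hb]
    have i2 : d.ofLp - pl.C *ᵥ ε.ofLp = -θ.ofLp := by simp [hd]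
    rw [i1, i2, hH, mulVec_neg, dotProduct_neg, ← mulVec_mulVec, dotProduct_mulVec_transpose_comm,
      dotProduct_add, dotProduct_comm _ b.ofLp, dotProduct_comm _ (H *ᵥ θ.ofLp)]
    ring
  rw [e1, e2] at h1
  rw [E_norm_sq_eq, E_norm_sq_eq] at hζ'
  simp only [E_norm_sq_eq, E_inner_eq, ofLp_app] at hζ' ⊢
  linarith

/-- c is the minimum of the form on the unit sphere, which is empty in dimension 0; homogeneity does
the rest. -/
theorem exists_coercive {n : ℕ} {P : Matrix (Fin n) (Fin n) ℝ} (hP : P.PosDef) :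
    ∃ c > 0, ∀ v : E n, c * ‖v‖ ^ 2 ≤ inner ℝ v (app P v) := by
  rcases subsingleton_or_nontrivial (E n) with hsub | hnt
  · exact ⟨1, one_pos, fun v => by simp [Subsingleton.elim v 0]⟩
  have hc : Continuous fun v : E n => inner ℝ v (app P v) :=
    continuous_id.inner (LinearMap.continuous_of_finiteDimensional _)
  obtain ⟨v, hv, hmin⟩ := (isCompact_sphere (0 : E n) 1).exists_isMinOn
    (NormedSpace.sphere_nonempty.2 zero_le_one) hc.continuousOn
  have hv1 : ‖v‖ = 1 := by simpa using hv
  have hpos : 0 < inner ℝ v (app P v) := by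
    have hv0 : v.ofLp ≠ 0 := fun h0 => by
      have : v = 0 := by ext i; simp [h0]
      simp [this] at hv1
    have := hP.dotProduct_mulVec_pos hv0
    rw [star_trivial] at this
    rwa [E_inner_eq]
  refine ⟨_, hpos, fun x => ?_⟩
  rcases eq_or_ne x 0 with rfl | hx
  · simp
  have hx' : 0 < ‖x‖ := norm_pos_iff.2 hx
  have h1 := hmin (a := ‖x‖⁻¹ • x) (by simp [norm_smul, hx'.ne'])
  simp only [mem_ofPred_eq, map_smul, real_inner_smul_left, real_inner_smul_right] at h1
  rw [← mul_assoc, ← sq, inv_pow, inv_mul_eq_div, le_div_iff₀ (by positivity)] at h1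
  exact h1

theorem exists_inner_app_le {n : ℕ} (P : Matrix (Fin n) (Fin n) ℝ) :
    ∃ c > 0, ∀ v : E n, inner ℝ v (app P v) ≤ c * ‖v‖ ^ 2 := by
  refine ⟨‖(Matrix.toEuclideanLin P).toContinuousLinearMap‖ + 1, by positivity, fun v => ?_⟩
  have h1 := (Matrix.toEuclideanLin P).toContinuousLinearMap.le_opNorm v
  have h2 := real_inner_le_norm v (app P v)
  have h3 : ‖app P v‖ ≤ ‖(Matrix.toEuclideanLin P).toContinuousLinearMap‖ * ‖v‖ := h1
  nlinarith [mul_le_mul_of_nonneg_left h3 (norm_nonneg v), norm_nonneg v]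

end LMI

end SporadicObserver

/-! ### Flows up to the next measurement, distance to the target, continuation for the closed loop
-/

namespace SporadicObserver

/-- The action of a matrix on Euclidean vectors, as a continuous linear map. -/
def appL {m n : ℕ} (M : Matrix (Fin m) (Fin n) ℝ) : E n →L[ℝ] E m :=
  LinearMap.toContinuousLinearMap (Matrix.toEuclideanLin M)

/-- If the vector field without disturbance is Lipschitz, and the flow set consists of the states
for which a timer of unit decreasing rate is in `[0, T₂]`, then one can flow until the timer
reaches `0`, at least for some time. -/
theorem HybridSystem.exists_flow_of_timer {X W V : Type*} [NormedAddCommGroup X] [NormedSpace ℝ X]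
    [CompleteSpace X] [NormedAddCommGroup W] (S : HybridSystem X W V) {K : ℝ≥0} {T₂ : ℝ}
    (hlip : LipschitzWith K fun y => S.flowMap y 0) (timer : X →L[ℝ] ℝ)
    (htimer : ∀ y, timer (S.flowMap y 0) = -1) (hF : S.flowSet = {x | timer x ∈ Icc 0 T₂}) {x : X}
    (hx : x ∈ S.flowSet) (hpos : 0 < timer x) :
    ∃ h > 0, ∃ ξ : ℝ → X, ξ 0 = x ∧ (∃ K, LipschitzOnWith K ξ (Icc 0 h)) ∧
      ∀ t ∈ Ioo 0 h, HasDerivAt ξ (S.flowMap (ξ t) 0) t ∧ ξ t ∈ S.flowSet := by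
  set f := fun y => S.flowMap y 0 with hf
  set M : ℝ≥0 := K + ‖f x‖₊ with hM
  -- M bounds the field on the unit ball around x, so h ≤ 1/(M + 1) keeps the solution in that ball;
  -- h ≤ timer x keeps the timer nonnegative.
  set h : ℝ := min (timer x) (1 / (M + 1)) with hh
  have hh0 : 0 < h := lt_min hpos (by positivity)
  have hpl : IsPicardLindelof (fun _ => f) (tmin := 0) (tmax := h) ⟨0, le_rfl, hh0.le⟩ x 1 0 M K :=
    { lipschitzOnWith := fun t _ => hlip.lipschitzOnWith
      continuousOn := fun y _ => continuousOn_const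
      norm_le := fun t _ y hy => by
        have h1 := hlip.norm_sub_le y x
        have h2 : ‖y - x‖ ≤ 1 := by simpa [dist_eq_norm] using hy
        have h3 := norm_le_norm_add_norm_sub' (f y) (f x)
        have h4 : (K : ℝ) * ‖y - x‖ ≤ K := mul_le_of_le_one_right K.2 h2
        rw [hM, NNReal.coe_add, coe_nnnorm]
        linarith
      mul_max_le := by
        have h1 : (M : ℝ) * h ≤ M * (1 / (M + 1)) :=
          mul_le_mul_of_nonneg_left (min_le_right _ _) M.2
        have h2 : (M : ℝ) * (1 / (M + 1)) ≤ 1 := by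
          rw [mul_one_div, div_le_one (by positivity)]
          linarith
        simpa [hh0.le] using h1.trans h2 }
  obtain ⟨ξ, hξ0, hξ⟩ := hpl.exists_eq_forall_mem_Icc_hasDerivWithinAt₀
  have hξ0' : ξ 0 = x := hξ0
  refine ⟨h, hh0, ξ, hξ0', ?_, fun t ht => ⟨(hξ t ⟨ht.1.le, ht.2.le⟩).hasDerivAt
    (Icc_mem_nhds ht.1 ht.2), ?_⟩⟩
  · have hc : ContinuousOn (fun t => f (ξ t)) (Icc 0 h) :=
      hlip.continuous.comp_continuousOn fun t ht => (hξ t ht).continuousWithinAt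
    obtain ⟨C, hC⟩ := isCompact_Icc.exists_bound_of_continuousOn hc
    refine ⟨C.toNNReal, (convex_Icc 0 h).lipschitzOnWith_of_nnnorm_hasDerivWithin_le hξ
      fun t ht => ?_⟩
    rw [← NNReal.coe_le_coe, coe_nnnorm]
    exact (hC t ht).trans (Real.le_coe_toNNReal C)
  -- Timer plus elapsed time has zero derivative, so it is constant.
  · have h1 := (convex_Icc (0 : ℝ) h).norm_image_sub_le_of_norm_hasDerivWithin_le
      (f := fun t => timer (ξ t) + t) (f' := fun _ => 0) (C := 0) (x := 0) (y := t)
      (fun s hs => by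
        have h2 := (timer.hasFDerivAt.comp_hasDerivWithinAt s (hξ s hs)).add
          (hasDerivWithinAt_id s _)
        have h3 : timer (f (ξ s)) + 1 = 0 := by rw [htimer]; exact neg_add_cancel 1
        rw [h3] at h2
        exact h2)
      (by simp) ⟨le_rfl, hh0.le⟩ ⟨ht.1.le, ht.2.le⟩
    rw [zero_mul, norm_le_zero_iff, hξ0'] at h1
    have h2 : h ≤ (timer x) := min_le_left _ _
    rw [hF] at hx ⊢
    exact ⟨by linarith [ht.2], by linarith [ht.1, hx.2]⟩

namespace State

variable {nz ny : ℕ}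

def zL : State nz ny →L[ℝ] E nz := WithLp.fstL 2 ℝ _ _

def zhatL : State nz ny →L[ℝ] E nz := (WithLp.fstL 2 ℝ _ _).comp (WithLp.sndL 2 ℝ _ _)

def θL : State nz ny →L[ℝ] E ny :=
  (WithLp.fstL 2 ℝ _ _).comp ((WithLp.sndL 2 ℝ _ _).comp (WithLp.sndL 2 ℝ _ _))

def τL : State nz ny →L[ℝ] ℝ :=
  (WithLp.sndL 2 ℝ _ _).comp ((WithLp.sndL 2 ℝ _ _).comp (WithLp.sndL 2 ℝ _ _))

def εL : State nz ny →L[ℝ] E nz := zL - zhatL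

theorem εL_apply (x : State nz ny) : εL x = x.ε := rfl

variable (a b : E nz) (c : E ny) (d : ℝ)

@[simp] theorem mk_θ : (mk a b c d).θ = c := rfl
@[simp] theorem mk_τ : (mk a b c d).τ = d := rfl
@[simp] theorem mk_ε : (mk a b c d).ε = a - b := rfl

theorem norm_sq_eq (x : State nz ny) :
    ‖x‖ ^ 2 = ‖x.z‖ ^ 2 + ‖x.zhat‖ ^ 2 + ‖x.θ‖ ^ 2 + x.τ ^ 2 := by
  rw [WithLp.prod_norm_sq_eq_of_L2, WithLp.prod_norm_sq_eq_of_L2, WithLp.prod_norm_sq_eq_of_L2,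
    Real.norm_eq_abs, sq_abs]
  simp only [z, zhat, θ, τ, add_assoc]

theorem norm_le (x : State nz ny) : ‖x‖ ≤ ‖x.z‖ + ‖x.zhat‖ + ‖x.θ‖ + |x.τ| := by
  refine abs_le_of_sq_le_sq' ?_ (by positivity) |>.2
  rw [norm_sq_eq, ← sq_abs x.τ]
  have := norm_nonneg x.z
  have := norm_nonneg x.zhat
  have := norm_nonneg x.θ
  have := abs_nonneg x.τ
  nlinarith [mul_nonneg (norm_nonneg x.z) (norm_nonneg x.zhat),
    mul_nonneg (norm_nonneg x.z) (norm_nonneg x.θ), mul_nonneg (norm_nonneg x.z) (abs_nonneg x.τ),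
    mul_nonneg (norm_nonneg x.zhat) (norm_nonneg x.θ),
    mul_nonneg (norm_nonneg x.zhat) (abs_nonneg x.τ), mul_nonneg (norm_nonneg x.θ) (abs_nonneg x.τ)]

end State

section Target

variable {nz ny : ℕ} {T₂ : ℝ}

/-- Comparison with the point of the target obtained by replacing ẑ by z and θ by 0. -/
theorem infDist_target_sq_le {x : State nz ny} (hx : x.τ ∈ Icc 0 T₂) :
    Metric.infDist x (target nz ny T₂) ^ 2 ≤ ‖x.ε‖ ^ 2 + ‖x.θ‖ ^ 2 := by
  have h1 := Metric.infDist_le_dist_of_mem (x := x) (s := target nz ny T₂)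
    (y := State.mk x.z x.z 0 x.τ) ⟨rfl, rfl, hx⟩
  refine (pow_le_pow_left₀ Metric.infDist_nonneg h1 2).trans ?_
  rw [dist_eq_norm, State.norm_sq_eq]
  have e1 : (x - State.mk x.z x.z 0 x.τ).z = 0 := sub_self x.z
  have e2 : (x - State.mk x.z x.z 0 x.τ).zhat = x.zhat - x.z := rfl
  have e3 : (x - State.mk x.z x.z 0 x.τ).θ = x.θ := sub_zero x.θ
  have e4 : (x - State.mk x.z x.z 0 x.τ).τ = 0 := sub_self x.τ
  rw [e1, e2, e3, e4, norm_sub_rev, State.ε]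
  simp

/-- For every y, |z - y|² + |ẑ - y|² ≥ |z - ẑ|²/2, whence the factor 1/2. Nonnegativity of T₂ makes
the target nonempty; otherwise `Metric.infDist` would be 0. -/
theorem le_infDist_target_sq (hT₂ : 0 ≤ T₂) (x : State nz ny) :
    ‖x.ε‖ ^ 2 / 2 + ‖x.θ‖ ^ 2 ≤ Metric.infDist x (target nz ny T₂) ^ 2 := by
  rw [← Real.sqrt_le_left Metric.infDist_nonneg]
  have hne : (target nz ny T₂).Nonempty := ⟨State.mk 0 0 0 0, rfl, rfl, le_rfl, hT₂⟩
  refine (Metric.le_infDist hne).2 fun {y} hy => ?_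
  rw [Real.sqrt_le_left dist_nonneg, dist_eq_norm, State.norm_sq_eq]
  have e1 : (x - y).z = x.z - y.z := rfl
  have e2 : (x - y).zhat = x.zhat - y.z := by rw [hy.1]; rfl
  have e3 : (x - y).θ = x.θ := by
    rw [show (x - y).θ = x.θ - y.θ from rfl, hy.2.1, sub_zero]
  have e4 : x.ε = (x.z - y.z) - (x.zhat - y.z) := by rw [State.ε]; abel
  rw [e1, e2, e3, e4]
  have := norm_sub_le (x.z - y.z) (x.zhat - y.z)
  nlinarith [sq_nonneg (‖x.z - y.z‖ - ‖x.zhat - y.z‖), sq_nonneg (x - y).τ,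
    norm_nonneg (x.z - y.z - (x.zhat - y.z)),
    pow_le_pow_left₀ (norm_nonneg (x.z - y.z - (x.zhat - y.z))) this 2]

end Target

section Continuation

variable {nz ny nw nq ns np : ℕ} (pl : Plant nz ny nw nq ns np) {T₁ T₂ : ℝ}
  (L : Matrix (Fin nz) (Fin ny) ℝ) (H : Matrix (Fin ny) (Fin ny) ℝ)

theorem Plant.lipschitzWith_ψ : LipschitzWith pl.ℓ.toNNReal pl.ψ :=
  LipschitzWith.of_dist_le_mul fun x y => by
    rw [dist_eq_norm, dist_eq_norm, Real.coe_toNNReal _ pl.ℓ_pos.le]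
    exact pl.lipschitz x y

/-- Joint Lipschitz continuity in state and disturbance serves twice: for linear growth, and for
Picard–Lindelöf with zero disturbance. -/
theorem exists_lipschitz_flowMap (T₁ T₂ : ℝ) : ∃ K : ℝ≥0, ∀ x y w v,
    ‖(closedLoop pl T₁ T₂ L H).flowMap x w - (closedLoop pl T₁ T₂ L H).flowMap y v‖ ≤
      K * ‖(x - y, w - v)‖ := by
  have h1 := fun (Q : State nz ny →L[ℝ] E nz) =>
    ((appL pl.A).lipschitz.comp (Q.lipschitz.comp
      (LipschitzWith.prod_fst (α := State nz ny) (β := E nw)))).add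
    ((appL pl.B).lipschitz.comp (pl.lipschitzWith_ψ.comp ((appL pl.S).lipschitz.comp
      (Q.lipschitz.comp (LipschitzWith.prod_fst (α := State nz ny) (β := E nw))))))
  obtain ⟨K₁, hz⟩ : ∃ K, LipschitzWith K fun p : State nz ny × E nw =>
      ((closedLoop pl T₁ T₂ L H).flowMap p.1 p.2).z :=
    ⟨_, (h1 State.zL).add ((appL pl.N).lipschitz.comp
      (LipschitzWith.prod_snd (α := State nz ny) (β := E nw)))⟩
  obtain ⟨K₂, hzh⟩ : ∃ K, LipschitzWith K fun p : State nz ny × E nw =>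
      ((closedLoop pl T₁ T₂ L H).flowMap p.1 p.2).zhat :=
    ⟨_, (h1 State.zhatL).add ((appL L).lipschitz.comp (State.θL.lipschitz.comp
      (LipschitzWith.prod_fst (α := State nz ny) (β := E nw))))⟩
  obtain ⟨K₃, hθ⟩ : ∃ K, LipschitzWith K fun p : State nz ny × E nw =>
      ((closedLoop pl T₁ T₂ L H).flowMap p.1 p.2).θ :=
    ⟨_, (appL H).lipschitz.comp (State.θL.lipschitz.comp
      (LipschitzWith.prod_fst (α := State nz ny) (β := E nw)))⟩
  refine ⟨K₁ + K₂ + K₃, fun x y w v => (State.norm_le _).trans ?_⟩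
  have i1 := hz.norm_sub_le (x, w) (y, v)
  have i2 := hzh.norm_sub_le (x, w) (y, v)
  have i3 := hθ.norm_sub_le (x, w) (y, v)
  rw [NNReal.coe_add, NNReal.coe_add, add_mul, add_mul]
  have i4 : ((closedLoop pl T₁ T₂ L H).flowMap x w - (closedLoop pl T₁ T₂ L H).flowMap y v).τ = 0 :=
    sub_self (-1 : ℝ)
  rw [i4, abs_zero, add_zero]
  exact add_le_add (add_le_add i1 i2) i3

theorem closedLoop_canContinue (hT₁ : 0 < T₁) (hT : T₁ ≤ T₂) :
    CanContinue (closedLoop pl T₁ T₂ L H) where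
  isClosed := isClosed_Icc.preimage State.τL.continuous
  growth := by
    obtain ⟨K, hK⟩ := exists_lipschitz_flowMap pl L H T₁ T₂
    refine ⟨K + ‖(closedLoop pl T₁ T₂ L H).flowMap 0 0‖, by positivity, fun x w => ?_⟩
    have h1 := hK x 0 w 0
    rw [sub_zero, sub_zero, Prod.norm_def] at h1
    have h2 := norm_le_norm_add_norm_sub' ((closedLoop pl T₁ T₂ L H).flowMap x w)
      ((closedLoop pl T₁ T₂ L H).flowMap 0 0)
    have h3 : max ‖x‖ ‖w‖ ≤ ‖x‖ + ‖w‖ := max_le_add_of_nonneg (norm_nonneg _) (norm_nonneg _)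
    have h4 := mul_le_mul_of_nonneg_left h3 K.2
    have h5 : 0 ≤ ‖(closedLoop pl T₁ T₂ L H).flowMap 0 0‖ * (‖x‖ + ‖w‖) := by positivity
    have h6 : (0 : ℝ) ≤ K := K.2
    simp only at h1
    change (K : ℝ) * max ‖x‖ ‖w‖ ≤ K * (‖x‖ + ‖w‖) at h4
    linarith
  jumpSet_subset := fun x hx => by
    have h1 : x.τ = 0 := hx
    exact ⟨h1.ge, h1.le.trans (hT₁.le.trans hT)⟩
  jumpMap_subset := by
    rintro x - η g ⟨v, hv, rfl⟩
    exact ⟨hT₁.le.trans hv.1, hv.2⟩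
  continue_from := fun x hx => by
    rcases hx.1.eq_or_lt with h0 | hpos
    · exact Or.inl ⟨h0.symm, fun η => ⟨_, T₁, ⟨le_rfl, hT⟩, rfl⟩⟩
    · obtain ⟨K, hK⟩ := exists_lipschitz_flowMap pl L H T₁ T₂
      refine Or.inr ((closedLoop pl T₁ T₂ L H).exists_flow_of_timer (K := K)
        (LipschitzWith.of_dist_le_mul fun y y' => ?_) State.τL (fun _ => rfl) rfl hx hpos)
      rw [dist_eq_norm, dist_eq_norm]
      simpa using hK y y' 0 0

end Continuation

end SporadicObserver

/-! ### The Lyapunov function along flows and its comparison with the distance -/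

namespace SporadicObserver

section Observables

variable {X W V F : Type*} [NormedAddCommGroup X] [NormedSpace ℝ X] [NormedAddCommGroup W]
  [NormedAddCommGroup V] [NormedAddCommGroup F] [NormedSpace ℝ F] {H : HybridSystem X W V}
  {D : Set (ℝ × ℕ)} {φ : ℝ → ℕ → X} {u : ℝ → ℕ → WithLp 2 (W × V)}

theorem IsSolutionPair.absolutelyContinuous_clm (hs : IsSolutionPair H D φ u) (Q : X →L[ℝ] F)
    {j : ℕ} {a b : ℝ} (hab : a ≤ b) (hI : Icc a b ⊆ slice D j) :
    AbsolutelyContinuousOnInterval (fun t => Q (φ t j)) a b :=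
  (hs.arc j a b hab hI).comp_lipschitzOnWith (s := univ) Q.lipschitz.lipschitzOnWith
    fun _ _ => mem_univ _

theorem IsSolutionPair.ae_hasDerivAt_clm (hs : IsSolutionPair H D φ u) (Q : X →L[ℝ] F)
    {j : ℕ} {a b : ℝ} (hI : Icc a b ⊆ slice D j) :
    ∀ᵐ t, t ∈ Ioo a b →
      HasDerivAt (fun s => Q (φ s j)) (Q (H.flowMap (φ t j) (u t j).fst)) t := by
  have h := hs.flow_eq j
  rw [ae_restrict_iff' isOpen_interior.measurableSet] at h
  filter_upwards [h] with t ht hmem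
  exact Q.hasFDerivAt.comp_hasDerivAt t
    (ht (interior_maximal (Ioo_subset_Icc_self.trans hI) isOpen_Ioo hmem))

end Observables

variable {nz ny nw nq ns np : ℕ} {pl : Plant nz ny nw nq ns np} {T₁ T₂ lam γ δ χ : ℝ}
  {P₁ : Matrix (Fin nz) (Fin nz) ℝ} {P₂ : Matrix (Fin ny) (Fin ny) ℝ}
  {X : Matrix (Fin nz) (Fin nz) ℝ} {U W : Matrix (Fin ny) (Fin ny) ℝ}
  {J : Matrix (Fin nz) (Fin ny) ℝ} {L : Matrix (Fin nz) (Fin ny) ℝ}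
  {H : Matrix (Fin ny) (Fin ny) ℝ} {D : Set (ℝ × ℕ)} {φ : ℝ → ℕ → State nz ny}
  {u : ℝ → ℕ → WithLp 2 (E nw × E ny)}

/-- The Lyapunov function `ε' P₁ ε + e^{δ τ} θ̃' P₂ θ̃` with `θ̃ = C ε - θ`. -/
def lyap (pl : Plant nz ny nw nq ns np) (δ : ℝ) (P₁ : Matrix (Fin nz) (Fin nz) ℝ)
    (P₂ : Matrix (Fin ny) (Fin ny) ℝ) (x : State nz ny) : ℝ :=
  inner ℝ x.ε (app P₁ x.ε) +
    Real.exp (δ * x.τ) * inner ℝ (app pl.C x.ε - x.θ) (app P₂ (app pl.C x.ε - x.θ))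

theorem app_sub {m n : ℕ} (M : Matrix (Fin m) (Fin n) ℝ) (v w : E n) :
    app M (v - w) = app M v - app M w := map_sub (Matrix.toEuclideanLin M) v w

theorem contDiff_inner_app {n : ℕ} (P : Matrix (Fin n) (Fin n) ℝ) :
    ContDiff ℝ 1 fun v : E n => inner ℝ v (app P v) :=
  contDiff_id.inner ℝ (appL P).contDiff

theorem hasDerivAt_inner_app {n : ℕ} {P : Matrix (Fin n) (Fin n) ℝ} (hP : P.PosDef)
    {v : ℝ → E n} {v' : E n} {t : ℝ} (hv : HasDerivAt v v' t) :
    HasDerivAt (fun s => inner ℝ (v s) (app P (v s))) (2 * inner ℝ v' (app P (v t))) t := by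
  have h1 : HasDerivAt (fun s => app P (v s)) (app P v') t :=
    (appL P).hasFDerivAt.comp_hasDerivAt t hv
  convert! hv.inner ℝ h1 using 1
  rw [inner_app_comm hP (v t) v']
  ring

/-- The output injection error `θ̃ = C ε - θ`. -/
def outputErrorL (pl : Plant nz ny nw nq ns np) : State nz ny →L[ℝ] E ny :=
  (appL pl.C).comp State.εL - State.θL

theorem τ_mem (hs : IsSolutionPair (closedLoop pl T₁ T₂ L H) D φ u) (hT₁ : 0 < T₁)
    (hT : T₁ ≤ T₂) : ∀ p ∈ D, (φ p.1 p.2).τ ∈ Icc 0 T₂ :=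
  have h := closedLoop_canContinue pl L H hT₁ hT
  hs.mem_flowSet h.isClosed h.jumpSet_subset h.jumpMap_subset

/-- τ + t and its negative are both nonincreasing. -/
theorem τ_flow (hs : IsSolutionPair (closedLoop pl T₁ T₂ L H) D φ u) {j : ℕ} {a b : ℝ}
    (hab : a ≤ b) (hI : Icc a b ⊆ slice D j) : (φ b j).τ = (φ a j).τ - (b - a) := by
  have h1 : AbsolutelyContinuousOnInterval (fun t => (φ t j).τ) a b :=
    hs.absolutelyContinuous_clm State.τL hab hI
  have h2 : AbsolutelyContinuousOnInterval (fun t => t) a b :=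
    LipschitzOnWith.absolutelyContinuousOnInterval LipschitzWith.id.lipschitzOnWith
  have h3 : ∀ᵐ t, t ∈ Ioo a b → HasDerivAt (fun s => (φ s j).τ) (-1) t :=
    hs.ae_hasDerivAt_clm State.τL hI
  have h4 := (h1.fun_add h2).le_of_ae_deriv_nonpos (g' := fun _ => -1 + 1) hab (by
    filter_upwards [h3] with t ht hm
    exact ⟨(ht hm).add (hasDerivAt_id t), by norm_num⟩)
  have h5 := (h1.fun_add h2).fun_neg.le_of_ae_deriv_nonpos (g' := fun _ => -(-1 + 1)) hab (by
    filter_upwards [h3] with t ht hm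
    exact ⟨((ht hm).add (hasDerivAt_id t)).neg, by norm_num⟩)
  linarith

theorem lyap_absolutelyContinuous (hs : IsSolutionPair (closedLoop pl T₁ T₂ L H) D φ u) {j : ℕ}
    {a b : ℝ} (hab : a ≤ b) (hI : Icc a b ⊆ slice D j) :
    AbsolutelyContinuousOnInterval (fun t => lyap pl δ P₁ P₂ (φ t j)) a b := by
  have h1 := (hs.absolutelyContinuous_clm State.εL hab hI).comp_contDiff (contDiff_inner_app P₁)
  have h2 := (hs.absolutelyContinuous_clm (outputErrorL pl) hab hI).comp_contDiff
    (contDiff_inner_app P₂)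
  have h3 := (hs.absolutelyContinuous_clm State.τL hab hI).comp_contDiff
    (q := fun r => Real.exp (δ * r)) (by fun_prop)
  exact h1.fun_add (h3.fun_mul h2)

/-- The Lyapunov inequality along flows. -/
theorem lyap_ae_deriv_le (h : LMIsFeasibleAt pl T₂ lam γ δ χ P₁ P₂ X U W J)
    (hL : J = Xᵀ * L) (hH : W = Uᵀ * H) (hT₁ : 0 < T₁) (hT : T₁ ≤ T₂)
    (hs : IsSolutionPair (closedLoop pl T₁ T₂ L H) D φ u) {j : ℕ}
    {a b : ℝ} (hI : Icc a b ⊆ slice D j) :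
    ∀ᵐ t, t ∈ Ioo a b →
      HasDerivAt (fun s => lyap pl δ P₁ P₂ (φ s j)) (deriv (fun s => lyap pl δ P₁ P₂ (φ s j)) t) t ∧
      deriv (fun s => lyap pl δ P₁ P₂ (φ s j)) t ≤ -(2 * lam) * lyap pl δ P₁ P₂ (φ t j)
        - ‖app pl.Cp (φ t j).ε‖ ^ 2 + γ ^ 2 * ‖(u t j).fst‖ ^ 2 := by
  filter_upwards [hs.ae_hasDerivAt_clm State.εL hI, hs.ae_hasDerivAt_clm (outputErrorL pl) hI,
    hs.ae_hasDerivAt_clm State.τL hI] with t h1 h2 h3 hm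
  set x := φ t j with hx
  set w := (u t j).fst with hw
  set ζ := pl.ψ (app pl.S x.z) - pl.ψ (app pl.S x.zhat) with hζdef
  set ε' := app pl.A x.ε + app pl.B ζ + app pl.N w - app L x.θ with hε'
  -- The error dynamics depend on z and ẑ separately only through ζ, which is treated as an input
  -- with |ζ| ≤ ℓ|Sε|.
  have e1 : State.εL ((closedLoop pl T₁ T₂ L H).flowMap x w) = ε' := by
    change (app pl.A x.z + app pl.B (pl.ψ (app pl.S x.z)) + app pl.N w) -
      (app pl.A x.zhat + app pl.B (pl.ψ (app pl.S x.zhat)) + app L x.θ) = ε'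
    rw [hε', hζdef, State.ε, app_sub, app_sub]
    abel
  have e2 : outputErrorL pl ((closedLoop pl T₁ T₂ L H).flowMap x w) =
      app pl.C ε' - app H x.θ := by
    rw [← e1]; rfl
  have h1' := h1 hm
  have h2' := h2 hm
  have h3' : HasDerivAt (fun s => (φ s j).τ) (-1) t := h3 hm
  rw [e1] at h1'
  rw [e2] at h2'
  have hd : HasDerivAt (fun s => lyap pl δ P₁ P₂ (φ s j)) _ t :=
    (hasDerivAt_inner_app h.P₁_pos h1').add
      ((h3'.const_mul δ).exp.mul (hasDerivAt_inner_app h.P₂_pos h2'))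
  refine ⟨hd.differentiableAt.hasDerivAt, ?_⟩
  rw [hd.deriv]
  have hτ : x.τ ∈ Icc 0 T₂ := τ_mem hs hT₁ hT (t, j) (hI (Ioo_subset_Icc_self hm))
  have he : Real.exp (δ * x.τ) ∈ Icc 1 (Real.exp (δ * T₂)) :=
    ⟨Real.one_le_exp (mul_nonneg h.δ_pos.le hτ.1),
      Real.exp_le_exp.2 (mul_le_mul_of_nonneg_left hτ.2 h.δ_pos.le)⟩
  have hζ : ‖ζ‖ ≤ pl.ℓ * ‖app pl.S x.ε‖ := by
    rw [State.ε, app_sub]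
    exact pl.lipschitz _ _
  have hdis := h.dissipation he hL hH hζ hε'
  simp only [State.εL_apply, ← hx, lyap] at hdis ⊢
  linarith

theorem lyap_nonneg (h : LMIsFeasibleAt pl T₂ lam γ δ χ P₁ P₂ X U W J) (x : State nz ny) :
    0 ≤ lyap pl δ P₁ P₂ x := by
  obtain ⟨c₁, hc₁, h₁⟩ := exists_coercive h.P₁_pos
  obtain ⟨c₂, hc₂, h₂⟩ := exists_coercive h.P₂_pos
  exact add_nonneg ((by positivity : 0 ≤ c₁ * ‖x.ε‖ ^ 2).trans (h₁ _))
    (mul_nonneg (Real.exp_pos _).le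
      ((by positivity : 0 ≤ c₂ * ‖app pl.C x.ε - x.θ‖ ^ 2).trans (h₂ _)))

/-- On the flow set, the Lyapunov function is comparable to the squared distance to the target. -/
theorem exists_lyap_bounds (h : LMIsFeasibleAt pl T₂ lam γ δ χ P₁ P₂ X U W J) (hT₂ : 0 ≤ T₂) :
    ∃ c₁ > 0, ∃ c₂ > 0, ∀ x : State nz ny, x.τ ∈ Icc 0 T₂ →
      c₁ * Metric.infDist x (target nz ny T₂) ^ 2 ≤ lyap pl δ P₁ P₂ x ∧
      lyap pl δ P₁ P₂ x ≤ c₂ * Metric.infDist x (target nz ny T₂) ^ 2 := by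
  obtain ⟨p₁, hp₁, h₁⟩ := exists_coercive h.P₁_pos
  obtain ⟨p₂, hp₂, h₂⟩ := exists_coercive h.P₂_pos
  obtain ⟨q₁, hq₁, k₁⟩ := exists_inner_app_le P₁
  obtain ⟨q₂, hq₂, k₂⟩ := exists_inner_app_le P₂
  set c := ‖appL pl.C‖ with hc
  have hc0 : 0 ≤ c := norm_nonneg _
  set M := Real.exp (δ * T₂) with hM
  have hM0 : 0 < M := Real.exp_pos _
  -- With d = Cε - θ, the lower constant comes from |ε|² + |θ|² ≤ (1 + 2c²)|ε|² + 2|d|², and the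
  -- upper one from |d|² ≤ 2c²|ε|² + 2|θ|² and |ε|²/2 + |θ|² ≤ dist².
  refine ⟨min (p₁ / (1 + 2 * c ^ 2)) (p₂ / 2), lt_min (by positivity) (by positivity),
    2 * q₁ + 4 * M * q₂ * c ^ 2 + 2 * M * q₂, by positivity, fun x hx => ?_⟩
  set d := app pl.C x.ε - x.θ with hd
  have he1 : 1 ≤ Real.exp (δ * x.τ) := Real.one_le_exp (mul_nonneg h.δ_pos.le hx.1)
  have he2 : Real.exp (δ * x.τ) ≤ M :=
    Real.exp_le_exp.2 (mul_le_mul_of_nonneg_left hx.2 h.δ_pos.le)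
  have hCε : ‖app pl.C x.ε‖ ^ 2 ≤ c ^ 2 * ‖x.ε‖ ^ 2 := by
    rw [← mul_pow]
    exact pow_le_pow_left₀ (norm_nonneg _) ((appL pl.C).le_opNorm x.ε) 2
  have hsq : ∀ y z : E ny, ‖y - z‖ ^ 2 ≤ 2 * ‖y‖ ^ 2 + 2 * ‖z‖ ^ 2 := fun y z => by
    have := pow_le_pow_left₀ (norm_nonneg _) (norm_sub_le y z) 2
    nlinarith [sq_nonneg (‖y‖ - ‖z‖)]
  have hd2 : ‖d‖ ^ 2 ≤ 2 * (c ^ 2 * ‖x.ε‖ ^ 2) + 2 * ‖x.θ‖ ^ 2 :=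
    (hsq _ _).trans (by linarith)
  have hθ2 : ‖x.θ‖ ^ 2 ≤ 2 * (c ^ 2 * ‖x.ε‖ ^ 2) + 2 * ‖d‖ ^ 2 := by
    have := hsq (app pl.C x.ε) d
    rw [hd, sub_sub_cancel] at this
    linarith
  have hdist1 := infDist_target_sq_le hx
  have hdist2 := le_infDist_target_sq hT₂ x
  have hP₂ : 0 ≤ inner ℝ d (app P₂ d) := (by positivity : 0 ≤ p₂ * ‖d‖ ^ 2).trans (h₂ d)
  constructor
  · set m := min (p₁ / (1 + 2 * c ^ 2)) (p₂ / 2) with hm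
    have hm0 : 0 ≤ m := le_min (by positivity) (by positivity)
    have hm1 : m * (1 + 2 * c ^ 2) ≤ p₁ :=
      (le_div_iff₀ (by positivity)).1 (min_le_left _ _)
    have hm2 : m * 2 ≤ p₂ := (le_div_iff₀ (by positivity)).1 (min_le_right _ _)
    calc m * Metric.infDist x (target nz ny T₂) ^ 2
        ≤ m * ((1 + 2 * c ^ 2) * ‖x.ε‖ ^ 2 + 2 * ‖d‖ ^ 2) :=
          mul_le_mul_of_nonneg_left (by linarith) hm0
      _ = m * (1 + 2 * c ^ 2) * ‖x.ε‖ ^ 2 + m * 2 * ‖d‖ ^ 2 := by ring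
      _ ≤ p₁ * ‖x.ε‖ ^ 2 + p₂ * ‖d‖ ^ 2 := by gcongr
      _ ≤ lyap pl δ P₁ P₂ x :=
          add_le_add (h₁ _) ((h₂ d).trans (le_mul_of_one_le_left hP₂ he1))
  · have i1 : Real.exp (δ * x.τ) * inner ℝ d (app P₂ d) ≤ M * (q₂ * ‖d‖ ^ 2) :=
      (mul_le_mul_of_nonneg_right he2 hP₂).trans (mul_le_mul_of_nonneg_left (k₂ d) hM0.le)
    have i2 : M * (q₂ * ‖d‖ ^ 2) ≤ M * (q₂ * (2 * (c ^ 2 * ‖x.ε‖ ^ 2) + 2 * ‖x.θ‖ ^ 2)) := by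
      gcongr
    calc lyap pl δ P₁ P₂ x
        ≤ q₁ * ‖x.ε‖ ^ 2 + M * (q₂ * (2 * (c ^ 2 * ‖x.ε‖ ^ 2) + 2 * ‖x.θ‖ ^ 2)) :=
          add_le_add (k₁ _) (i1.trans i2)
      _ ≤ (2 * q₁ + 4 * M * q₂ * c ^ 2 + 2 * M * q₂) * (‖x.ε‖ ^ 2 / 2 + ‖x.θ‖ ^ 2) := by
          have : 0 ≤ (2 * q₁ + 4 * M * q₂ * c ^ 2) * ‖x.θ‖ ^ 2 + M * q₂ * ‖x.ε‖ ^ 2 := by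
            positivity
          nlinarith
      _ ≤ _ := mul_le_mul_of_nonneg_left hdist2 (by positivity)

end SporadicObserver

/-! ### Exponential stability and input-to-state stability -/

namespace SporadicObserver

variable {nz ny nw nq ns np : ℕ} {pl : Plant nz ny nw nq ns np} {T₁ T₂ lam γ δ χ : ℝ}
  {P₁ : Matrix (Fin nz) (Fin nz) ℝ} {P₂ : Matrix (Fin ny) (Fin ny) ℝ}
  {X : Matrix (Fin nz) (Fin nz) ℝ} {U W : Matrix (Fin ny) (Fin ny) ℝ}
  {J : Matrix (Fin nz) (Fin ny) ℝ} {L : Matrix (Fin nz) (Fin ny) ℝ}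
  {H : Matrix (Fin ny) (Fin ny) ℝ} {D : Set (ℝ × ℕ)} {φ : ℝ → ℕ → State nz ny}
  {u : ℝ → ℕ → WithLp 2 (E nw × E ny)}

/-- G is the level at which decay balances the disturbance: V' ≤ -2λ(V - G), so e^{2λt}(V - G) is
nonincreasing. -/
theorem lyap_flow_le (h : LMIsFeasibleAt pl T₂ lam γ δ χ P₁ P₂ X U W J)
    (hL : J = Xᵀ * L) (hH : W = Uᵀ * H) (hT₁ : 0 < T₁) (hT : T₁ ≤ T₂)
    (hs : IsSolutionPair (closedLoop pl T₁ T₂ L H) D φ u) {j : ℕ}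
    {a b G : ℝ} (hab : a ≤ b) (hI : Icc a b ⊆ slice D j)
    (hG : ∀ᵐ t, t ∈ Ioo a b → γ ^ 2 * ‖(u t j).fst‖ ^ 2 ≤ 2 * lam * G) :
    lyap pl δ P₁ P₂ (φ b j) ≤
      G + Real.exp (-(2 * lam) * (b - a)) * (lyap pl δ P₁ P₂ (φ a j) - G) := by
  have h1 := lyap_absolutelyContinuous (δ := δ) (P₁ := P₁) (P₂ := P₂) hs hab hI
  have h2 : AbsolutelyContinuousOnInterval (fun t => Real.exp (2 * lam * t)) a b :=
    (ContDiff.contDiffOn (by fun_prop)).absolutelyContinuousOnInterval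
  have h3 : AbsolutelyContinuousOnInterval (fun _ => G) a b :=
    LipschitzOnWith.absolutelyContinuousOnInterval (K := 0)
      (LipschitzWith.const _).lipschitzOnWith
  have h4 := (h2.fun_mul (h1.fun_sub h3)).le_of_ae_deriv_nonpos (g' := fun t =>
    Real.exp (2 * lam * t) * (2 * lam) * (lyap pl δ P₁ P₂ (φ t j) - G) +
      Real.exp (2 * lam * t) * deriv (fun s => lyap pl δ P₁ P₂ (φ s j)) t) hab (by
    filter_upwards [lyap_ae_deriv_le h hL hH hT₁ hT hs hI, hG] with t ht hGt hm
    obtain ⟨hd, hle⟩ := ht hm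
    constructor
    · have e1 : HasDerivAt (fun t => Real.exp (2 * lam * t))
          (Real.exp (2 * lam * t) * (2 * lam)) t := by
        simpa using ((hasDerivAt_id t).const_mul (2 * lam)).exp
      exact e1.mul (hd.sub_const G)
    · have e2 : 2 * lam * (lyap pl δ P₁ P₂ (φ t j) - G) +
          deriv (fun s => lyap pl δ P₁ P₂ (φ s j)) t ≤ 0 := by
        have := hGt hm
        have := sq_nonneg ‖app pl.Cp (φ t j).ε‖
        linarith
      rw [mul_assoc, ← mul_add]
      exact mul_nonpos_of_nonneg_of_nonpos (Real.exp_pos _).le e2)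
  have e3 : Real.exp (-(2 * lam) * (b - a)) =
      Real.exp (-(2 * lam) * b) * Real.exp (2 * lam * a) := by
    rw [← Real.exp_add]; ring_nf
  have e4 : Real.exp (-(2 * lam) * b) * Real.exp (2 * lam * b) = 1 := by
    rw [← Real.exp_add]; ring_nf; exact Real.exp_zero
  have h5 := mul_le_mul_of_nonneg_left h4 (Real.exp_pos (-(2 * lam) * b)).le
  rw [← mul_assoc, e4, one_mul, ← mul_assoc, ← e3] at h5
  linarith

theorem lyap_jump_eq (hs : IsSolutionPair (closedLoop pl T₁ T₂ L H) D φ u) {p : ℝ × ℕ}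
    (hp : p ∈ jumpTimes D) : (φ p.1 p.2).τ = 0 ∧ (φ p.1 (p.2 + 1)).τ ∈ Icc T₁ T₂ ∧
      lyap pl δ P₁ P₂ (φ p.1 (p.2 + 1)) =
        inner ℝ (φ p.1 p.2).ε (app P₁ (φ p.1 p.2).ε) +
        Real.exp (δ * (φ p.1 (p.2 + 1)).τ) *
          inner ℝ (u p.1 p.2).snd (app P₂ (u p.1 p.2).snd) := by
  obtain ⟨h0, v, hv, hg⟩ := hs.jump p hp
  refine ⟨h0, by rw [hg]; exact hv, ?_⟩
  rw [hg]
  set x := φ p.1 p.2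
  set η := (u p.1 p.2).snd
  have e1 : app pl.C (x.z - x.zhat) - (app pl.C x.z + η - app pl.C x.zhat) = -η := by
    rw [app_sub]; abel
  simp only [lyap, State.mk_ε, State.mk_θ, State.mk_τ]
  rw [e1, show app P₂ (-η) = -app P₂ η from map_neg (Matrix.toEuclideanLin P₂) η, inner_neg_neg]
  rfl

/-- A jump erases the old θ̃, whose contribution to V is nonnegative, and replaces it by -η. -/
theorem lyap_jump_le (h : LMIsFeasibleAt pl T₂ lam γ δ χ P₁ P₂ X U W J)
    (hs : IsSolutionPair (closedLoop pl T₁ T₂ L H) D φ u) {p : ℝ × ℕ}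
    (hp : p ∈ jumpTimes D) : lyap pl δ P₁ P₂ (φ p.1 (p.2 + 1)) ≤ lyap pl δ P₁ P₂ (φ p.1 p.2) +
      Real.exp (δ * T₂) * inner ℝ (u p.1 p.2).snd (app P₂ (u p.1 p.2).snd) := by
  obtain ⟨-, hτ, h1⟩ := lyap_jump_eq (δ := δ) (P₁ := P₁) (P₂ := P₂) hs hp
  obtain ⟨c₂, hc₂, h₂⟩ := exists_coercive h.P₂_pos
  have h3 : ∀ v, 0 ≤ inner ℝ v (app P₂ v) := fun v =>
    (by positivity : 0 ≤ c₂ * ‖v‖ ^ 2).trans (h₂ v)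
  rw [h1]
  refine add_le_add (le_add_of_nonneg_right (mul_nonneg (Real.exp_pos _).le (h3 _)))
    (mul_le_mul_of_nonneg_right ?_ (h3 _))
  exact Real.exp_le_exp.2 (mul_le_mul_of_nonneg_left hτ.2 h.δ_pos.le)

/-- The number of jumps is bounded in terms of the ordinary time. -/
theorem jump_count_le (hT₁ : 0 < T₁) (hT : T₁ ≤ T₂)
    (hs : IsSolutionPair (closedLoop pl T₁ T₂ L H) D φ u) :
    ∀ p ∈ D, T₁ * p.2 ≤ p.1 + T₂ := by
  intro p hp
  -- Flows preserve t + τ, and each jump raises τ from 0 to at least T₁.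
  have h1 : ∀ p ∈ D, T₁ * p.2 ≤ p.1 + (φ p.1 p.2).τ := by
    refine hs.domain.induction (Q := fun t j => T₁ * j ≤ t + (φ t j).τ) ?_ ?_ ?_
    · simpa using (τ_mem hs hT₁ hT _ hs.domain.zero_mem).1
    · intro j a b hab hI ha
      rw [τ_flow hs hab hI]
      linarith
    · intro p hp hq
      obtain ⟨h0, v, hv, hg⟩ := hs.jump p hp
      have h0' : (φ p.1 p.2).τ = 0 := h0
      rw [hg, State.mk_τ]
      push_cast
      linarith [hv.1]
  linarith [h1 p hp, (τ_mem hs hT₁ hT p hp).2]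

/-- Bounded jump increments need not accumulate, since consecutive jumps are T₁ apart. The
comparison function carries a term B m² e^{2λτ}, which decays like e^{-2λt} on flows and at a jump
rises from B m² to at least B m² e^{2λT₁}, making room for the increment. -/
theorem exists_lyap_bound (h : LMIsFeasibleAt pl T₂ lam γ δ χ P₁ P₂ X U W J)
    (hL : J = Xᵀ * L) (hH : W = Uᵀ * H) (hT₁ : 0 < T₁) (hT : T₁ ≤ T₂) (hlam : 0 < lam) :
    ∃ C > 0, ∀ D φ u, IsSolutionPair (closedLoop pl T₁ T₂ L H) D φ u → ∀ m : ℝ,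
      (∀ j, ∀ᵐ t : ℝ, (t, j) ∈ D → ‖u t j‖ ≤ m) → (∀ p ∈ jumpTimes D, ‖u p.1 p.2‖ ≤ m) →
      ∀ p ∈ D, lyap pl δ P₁ P₂ (φ p.1 p.2) ≤
        Real.exp (-(2 * lam) * p.1) * lyap pl δ P₁ P₂ (φ 0 0) + C * m ^ 2 := by
  obtain ⟨q, hq, k⟩ := exists_inner_app_le P₂
  set M := Real.exp (δ * T₂) with hM
  have hM0 : 0 < M := Real.exp_pos _
  have hr : 0 < Real.exp (2 * lam * T₁) - 1 := by
    rw [sub_pos, Real.one_lt_exp_iff]; positivity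
  -- B solves Mq + B = B e^{2λT₁}, where M q m² bounds the jump increment.
  set B := M * q / (Real.exp (2 * lam * T₁) - 1) with hB
  have hB0 : 0 < B := by positivity
  have hBeq : M * q + B = B * Real.exp (2 * lam * T₁) := by
    rw [hB]; field_simp; ring
  refine ⟨γ ^ 2 / (2 * lam) + B * Real.exp (2 * lam * T₂), by positivity,
    fun D φ u hs m hw hη p hp => ?_⟩
  have key : ∀ p ∈ D, lyap pl δ P₁ P₂ (φ p.1 p.2) ≤
      Real.exp (-(2 * lam) * p.1) * lyap pl δ P₁ P₂ (φ 0 0) + γ ^ 2 * m ^ 2 / (2 * lam) +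
        B * m ^ 2 * Real.exp (2 * lam * (φ p.1 p.2).τ) := by
    refine hs.domain.induction (Q := fun t j => lyap pl δ P₁ P₂ (φ t j) ≤
      Real.exp (-(2 * lam) * t) * lyap pl δ P₁ P₂ (φ 0 0) + γ ^ 2 * m ^ 2 / (2 * lam) +
        B * m ^ 2 * Real.exp (2 * lam * (φ t j).τ)) ?_ ?_ ?_
    · rw [mul_zero, Real.exp_zero, one_mul, add_assoc]
      exact le_add_of_nonneg_right (by positivity)
    · intro j a b hab hI ha
      have h1 := lyap_flow_le h hL hH hT₁ hT hs (G := γ ^ 2 * m ^ 2 / (2 * lam)) hab hI (by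
        filter_upwards [hw j] with t ht hm
        rw [mul_div_cancel₀ _ (by positivity)]
        exact mul_le_mul_of_nonneg_left (pow_le_pow_left₀ (norm_nonneg _)
          ((WithLp.norm_fst_le _ _).trans (ht (hI (Ioo_subset_Icc_self hm)))) 2) (sq_nonneg γ))
      have e1 : Real.exp (-(2 * lam) * b) =
          Real.exp (-(2 * lam) * (b - a)) * Real.exp (-(2 * lam) * a) := by
        rw [← Real.exp_add]; ring_nf
      have e2 : Real.exp (2 * lam * (φ b j).τ) =
          Real.exp (-(2 * lam) * (b - a)) * Real.exp (2 * lam * (φ a j).τ) := by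
        rw [← Real.exp_add, τ_flow hs hab hI]; ring_nf
      have h2 := mul_le_mul_of_nonneg_left ha (Real.exp_pos (-(2 * lam) * (b - a))).le
      rw [e1, e2]
      linarith
    · intro p hp ha
      have h1 := lyap_jump_le h hs hp
      obtain ⟨h0, hτ, -⟩ := lyap_jump_eq (δ := δ) (P₁ := P₁) (P₂ := P₂) hs hp
      rw [h0, mul_zero, Real.exp_zero, mul_one] at ha
      have h2 : inner ℝ (u p.1 p.2).snd (app P₂ (u p.1 p.2).snd) ≤ q * m ^ 2 :=
        (k _).trans (mul_le_mul_of_nonneg_left (pow_le_pow_left₀ (norm_nonneg _)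
          ((WithLp.norm_snd_le _ _).trans (hη p hp)) 2) hq.le)
      have h3 := mul_le_mul_of_nonneg_left h2 hM0.le
      have h4 : Real.exp (2 * lam * T₁) ≤ Real.exp (2 * lam * (φ p.1 (p.2 + 1)).τ) :=
        Real.exp_le_exp.2 (mul_le_mul_of_nonneg_left hτ.1 (by positivity))
      have h5 := mul_le_mul_of_nonneg_left h4 (by positivity : 0 ≤ B * m ^ 2)
      have h6 : M * (q * m ^ 2) + B * m ^ 2 = B * m ^ 2 * Real.exp (2 * lam * T₁) := by
        rw [mul_right_comm, ← hBeq]; ring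
      linarith
  have h1 := key p hp
  have h2 : Real.exp (2 * lam * (φ p.1 p.2).τ) ≤ Real.exp (2 * lam * T₂) :=
    Real.exp_le_exp.2 (mul_le_mul_of_nonneg_left (τ_mem hs hT₁ hT p hp).2 (by positivity))
  have h3 := mul_le_mul_of_nonneg_left h2 (by positivity : 0 ≤ B * m ^ 2)
  have h4 : γ ^ 2 * m ^ 2 / (2 * lam) = γ ^ 2 / (2 * lam) * m ^ 2 := by ring
  rw [h4] at h1
  linarith

theorem exists_infDist_bound (h : LMIsFeasibleAt pl T₂ lam γ δ χ P₁ P₂ X U W J)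
    (hL : J = Xᵀ * L) (hH : W = Uᵀ * H) (hT₁ : 0 < T₁) (hT : T₁ ≤ T₂) (hlam : 0 < lam) :
    ∃ κ > 0, ∃ C > 0, ∀ D φ u, IsSolutionPair (closedLoop pl T₁ T₂ L H) D φ u → ∀ m : ℝ, 0 ≤ m →
      (∀ j, ∀ᵐ t : ℝ, (t, j) ∈ D → ‖u t j‖ ≤ m) → (∀ p ∈ jumpTimes D, ‖u p.1 p.2‖ ≤ m) →
      ∀ p ∈ D, Metric.infDist (φ p.1 p.2) (target nz ny T₂) ≤
        κ * Real.exp (-lam * p.1) * Metric.infDist (φ 0 0) (target nz ny T₂) + C * m := by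
  obtain ⟨C, hC, hb⟩ := exists_lyap_bound h hL hH hT₁ hT hlam
  obtain ⟨c₁, hc₁, c₂, hc₂, hV⟩ := exists_lyap_bounds h (hT₁.le.trans hT)
  refine ⟨√(c₂ / c₁), by positivity, √(C / c₁), by positivity,
    fun D φ u hs m hm hw hη p hp => ?_⟩
  set d := Metric.infDist (φ p.1 p.2) (target nz ny T₂)
  set d₀ := Metric.infDist (φ 0 0) (target nz ny T₂) with hd₀
  have hd₀' : 0 ≤ d₀ := Metric.infDist_nonneg
  have h1 := (hV _ (τ_mem hs hT₁ hT p hp)).1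
  have h2 := (hV _ (τ_mem hs hT₁ hT _ hs.domain.zero_mem)).2
  have h3 := hb D φ u hs m hw hη p hp
  have h4 := mul_le_mul_of_nonneg_left h2 (Real.exp_pos (-(2 * lam) * p.1)).le
  have e1 : Real.exp (-(2 * lam) * p.1) = Real.exp (-lam * p.1) ^ 2 := by
    rw [← Real.exp_nat_mul]; ring_nf
  refine abs_le_of_sq_le_sq' ?_ (by positivity) |>.2
  have e2 : √(c₂ / c₁) ^ 2 = c₂ / c₁ := Real.sq_sqrt (by positivity)
  have e3 : √(C / c₁) ^ 2 = C / c₁ := Real.sq_sqrt (by positivity)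
  have h5 : d ^ 2 ≤ c₂ / c₁ * (Real.exp (-lam * p.1) ^ 2 * d₀ ^ 2) + C / c₁ * m ^ 2 := by
    rw [div_mul_eq_mul_div, div_mul_eq_mul_div, ← add_div, le_div_iff₀ hc₁]
    rw [← e1]
    linarith
  rw [← e2, ← e3] at h5
  have h6 : 0 ≤ √(c₂ / c₁) * Real.exp (-lam * p.1) * d₀ * (√(C / c₁) * m) := by positivity
  nlinarith

/-- From T₁ j ≤ t + T₂ one gets T₁(t + j) ≤ (1 + T₁)(t + T₂): decay in ordinary time is decay in
hybrid time at a smaller rate. -/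
theorem exp_le_hybrid_exp (hT₁ : 0 < T₁) (hT : T₁ ≤ T₂) (hlam : 0 < lam)
    (hs : IsSolutionPair (closedLoop pl T₁ T₂ L H) D φ u) {p : ℝ × ℕ} (hp : p ∈ D) :
    Real.exp (-lam * p.1) ≤
      Real.exp (lam * T₂) * Real.exp (-(lam * T₁ / (1 + T₁)) * (p.1 + p.2)) := by
  rw [← Real.exp_add, Real.exp_le_exp]
  have h1 := jump_count_le hT₁ hT hs p hp
  have hT₂ : 0 < T₂ := hT₁.trans_le hT
  have h2 : lam * T₁ / (1 + T₁) * (p.1 + p.2) ≤ lam * (p.1 + T₂) := by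
    rw [div_mul_eq_mul_div, div_le_iff₀ (by positivity), mul_assoc, mul_assoc]
    refine mul_le_mul_of_nonneg_left ?_ hlam.le
    nlinarith
  linarith

theorem isGloballyExpStable_closedLoop (h : LMIsFeasibleAt pl T₂ lam γ δ χ P₁ P₂ X U W J)
    (hL : J = Xᵀ * L) (hH : W = Uᵀ * H) (hT₁ : 0 < T₁) (hT : T₁ ≤ T₂) (hlam : 0 < lam) :
    IsGloballyExpStable (closedLoop pl T₁ T₂ L H) (target nz ny T₂) lam := by
  refine ⟨(closedLoop_canContinue pl L H hT₁ hT).maximalAreComplete_isZeroInput, ?_⟩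
  obtain ⟨κ, hκ, C, hC, hb⟩ := exists_infDist_bound h hL hH hT₁ hT hlam
  refine ⟨κ * Real.exp (lam * T₂), by positivity, lam * T₁ / (1 + T₁), by positivity,
    fun D φ u hs hz p hp => ?_⟩
  have h1 := hb D φ u hs 0 le_rfl
    (fun j => Eventually.of_forall fun t ht => by rw [hz (t, j) ht, norm_zero])
    (fun p hp => by rw [hz p hp.1, norm_zero]) p hp
  rw [mul_zero, add_zero] at h1
  have hd₀ : 0 ≤ Metric.infDist (φ 0 0) (target nz ny T₂) := Metric.infDist_nonneg
  constructor
  · refine h1.trans (mul_le_mul_of_nonneg_right ?_ hd₀)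
    rw [mul_assoc]
    exact mul_le_mul_of_nonneg_left (exp_le_hybrid_exp hT₁ hT hlam hs hp) hκ.le
  · refine h1.trans (mul_le_mul_of_nonneg_right (mul_le_mul_of_nonneg_right ?_
      (Real.exp_pos _).le) hd₀)
    exact le_mul_of_one_le_right hκ.le
      (Real.one_le_exp (mul_nonneg hlam.le (hT₁.le.trans hT)))

/-- The factors 2 come from a + b ≤ max(2a, 2b). -/
theorem exists_iss_bound (h : LMIsFeasibleAt pl T₂ lam γ δ χ P₁ P₂ X U W J)
    (hL : J = Xᵀ * L) (hH : W = Uᵀ * H) (hT₁ : 0 < T₁) (hT : T₁ ≤ T₂) (hlam : 0 < lam) :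
    ∃ κ > 0, ∃ μ > 0, ∃ C > 0, ∀ D φ u, IsSolutionPair (closedLoop pl T₁ T₂ L H) D φ u →
      supNorm D u < ∞ → ∀ p ∈ D, Metric.infDist (φ p.1 p.2) (target nz ny T₂) ≤
        max (κ * Real.exp (-μ * (p.1 + p.2)) * Metric.infDist (φ 0 0) (target nz ny T₂))
          (C * (supNorm D u).toReal) := by
  obtain ⟨κ, hκ, C, hC, hb⟩ := exists_infDist_bound h hL hH hT₁ hT hlam
  refine ⟨2 * (κ * Real.exp (lam * T₂)), by positivity, lam * T₁ / (1 + T₁), by positivity, 2 * C,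
    by positivity, fun D φ u hs hu p hp => ?_⟩
  have h1 := hb D φ u hs _ ENNReal.toReal_nonneg (hs.domain.ae_norm_le_supNorm hu)
    (fun p hp => norm_le_supNorm_of_mem_jumpTimes hu hp) p hp
  have hd₀ : 0 ≤ Metric.infDist (φ 0 0) (target nz ny T₂) := Metric.infDist_nonneg
  have h2 : κ * Real.exp (-lam * p.1) * Metric.infDist (φ 0 0) (target nz ny T₂) ≤
      κ * Real.exp (lam * T₂) * Real.exp (-(lam * T₁ / (1 + T₁)) * (p.1 + p.2)) *
        Metric.infDist (φ 0 0) (target nz ny T₂) := by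
    refine mul_le_mul_of_nonneg_right ?_ hd₀
    rw [mul_assoc]
    exact mul_le_mul_of_nonneg_left (exp_le_hybrid_exp hT₁ hT hlam hs hp) hκ.le
  rcases le_total (κ * Real.exp (lam * T₂) * Real.exp (-(lam * T₁ / (1 + T₁)) * (p.1 + p.2)) *
        Metric.infDist (φ 0 0) (target nz ny T₂)) (C * (supNorm D u).toReal) with hle | hle
  · exact le_max_of_le_right (by linarith)
  · exact le_max_of_le_left (by linarith)

theorem isExpISS_closedLoop (h : LMIsFeasibleAt pl T₂ lam γ δ χ P₁ P₂ X U W J)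
    (hL : J = Xᵀ * L) (hH : W = Uᵀ * H) (hT₁ : 0 < T₁) (hT : T₁ ≤ T₂) (hlam : 0 < lam) :
    IsExpISS (closedLoop pl T₁ T₂ L H) (target nz ny T₂) := by
  refine ⟨(closedLoop_canContinue pl L H hT₁ hT).maximalAreComplete_isBoundedOnBounded, ?_⟩
  obtain ⟨κ, hκ, μ, hμ, C, hC, hb⟩ := exists_iss_bound h hL hH hT₁ hT hlam
  exact ⟨κ, hκ, μ, hμ, fun s => C * s, ⟨by fun_prop,
    fun a _ b _ hab => mul_lt_mul_of_pos_left hab hC, mul_zero C⟩, hb⟩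

theorem exists_error_bound (h : LMIsFeasibleAt pl T₂ lam γ δ χ P₁ P₂ X U W J)
    (hL : J = Xᵀ * L) (hH : W = Uᵀ * H) (hT₁ : 0 < T₁) (hT : T₁ ≤ T₂) (hlam : 0 < lam)
    (hs : IsSolutionPair (closedLoop pl T₁ T₂ L H) D φ u) (hu : supNorm D u < ∞) :
    ∃ M : ℝ, ∀ p ∈ D, ‖(φ p.1 p.2).ε‖ ≤ M := by
  obtain ⟨κ, hκ, μ, hμ, C, hC, hb⟩ := exists_iss_bound h hL hH hT₁ hT hlam
  set R := max (κ * Metric.infDist (φ 0 0) (target nz ny T₂)) (C * (supNorm D u).toReal) with hR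
  -- From |ε|²/2 ≤ R² one has |ε| ≤ √2 R ≤ 2R.
  refine ⟨2 * R, fun p hp => ?_⟩
  have h1 := le_infDist_target_sq (hT₁.le.trans hT) (φ p.1 p.2)
  have hd₀ : 0 ≤ Metric.infDist (φ 0 0) (target nz ny T₂) := Metric.infDist_nonneg
  have h2 : Metric.infDist (φ p.1 p.2) (target nz ny T₂) ≤ R := by
    refine (hb D φ u hs hu p hp).trans (max_le_max ?_ le_rfl)
    refine mul_le_mul_of_nonneg_right (mul_le_of_le_one_right hκ.le ?_) hd₀
    rw [Real.exp_le_one_iff, neg_mul, neg_nonpos]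
    exact mul_nonneg hμ.le (add_nonneg (hs.domain.nonneg hp) (Nat.cast_nonneg _))
  have h3 : (0 : ℝ) ≤ Metric.infDist (φ p.1 p.2) (target nz ny T₂) := Metric.infDist_nonneg
  refine abs_le_of_sq_le_sq' ?_ (by linarith) |>.2
  nlinarith [sq_nonneg ‖(φ p.1 p.2).θ‖, pow_le_pow_left₀ h3 h2 2, sq_nonneg R]

end SporadicObserver

/-! ### The L₂ gain -/

/-- An integral over a set of reals is the limit of its truncations at points of the set. -/
theorem MeasureTheory.setLIntegral_le_of_forall_inter_Iic {S : Set ℝ} {f : ℝ → ℝ≥0∞} {B : ℝ≥0∞}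
    (h : ∀ s ∈ S, ∫⁻ x in S ∩ Iic s, f x ≤ B) : ∫⁻ x in S, f x ≤ B := by
  rcases S.eq_empty_or_nonempty with rfl | hne
  · simp
  obtain ⟨v, hv, hcov⟩ : ∃ v : ℕ → ℝ, (∀ n, v n ∈ S) ∧
      ∀ᵐ x : ℝ, x ∈ S → ∃ n, x ≤ v n := by
    -- If S is bounded, points of S tending to its supremum cover all of S except possibly the
    -- supremum, a null set.
    by_cases hb : BddAbove S
    · obtain ⟨v, -, htend, hv⟩ := exists_seq_tendsto_sSup hne hb
      refine ⟨v, hv, ?_⟩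
      have hne' : ∀ᵐ s : ℝ, s ≠ sSup S := by simp [ae_iff]
      filter_upwards [hne'] with x hx hxS
      obtain ⟨n, hn⟩ := (htend.eventually
        (Ioi_mem_nhds (lt_of_le_of_ne (le_csSup hb hxS) hx))).exists
      exact ⟨n, le_of_lt hn⟩
    · have : ∀ n : ℕ, ∃ s ∈ S, (n : ℝ) < s := fun n => by
        by_contra! hc
        exact hb ⟨n, hc⟩
      choose v hv hvn using this
      refine ⟨v, hv, Eventually.of_forall fun x _ => ?_⟩
      obtain ⟨N, hN⟩ := exists_nat_ge x
      exact ⟨N, hN.trans (hvn N).le⟩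
  have hd : Directed (· ⊆ ·) fun n => S ∩ Iic (v n) :=
    fun m n => by
      rcases le_total (v m) (v n) with hmn | hmn
      · exact ⟨n, inter_subset_inter_right _ (Iic_subset_Iic.2 hmn), subset_rfl⟩
      · exact ⟨m, subset_rfl, inter_subset_inter_right _ (Iic_subset_Iic.2 hmn)⟩
  calc ∫⁻ x in S, f x ≤ ∫⁻ x in ⋃ n, S ∩ Iic (v n), f x := by
        refine lintegral_mono' (Measure.restrict_mono_ae ?_) le_rfl
        filter_upwards [hcov] with x hx hxS
        obtain ⟨n, hn⟩ := hx hxS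
        exact mem_iUnion.2 ⟨n, hxS, hn⟩
    _ = ⨆ n, ∫⁻ x in S ∩ Iic (v n), f x := setLIntegral_iUnion_of_directed f hd
    _ ≤ B := iSup_le fun n => h _ (hv n)

namespace SporadicObserver

variable {nz ny nw nq ns np : ℕ} {pl : Plant nz ny nw nq ns np} {T₁ T₂ lam γ δ χ : ℝ}
  {P₁ : Matrix (Fin nz) (Fin nz) ℝ} {P₂ : Matrix (Fin ny) (Fin ny) ℝ}
  {X : Matrix (Fin nz) (Fin nz) ℝ} {U W : Matrix (Fin ny) (Fin ny) ℝ}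
  {J : Matrix (Fin nz) (Fin ny) ℝ} {L : Matrix (Fin nz) (Fin ny) ℝ}
  {H : Matrix (Fin ny) (Fin ny) ℝ} {D : Set (ℝ × ℕ)} {φ : ℝ → ℕ → State nz ny}
  {u : ℝ → ℕ → WithLp 2 (E nw × E ny)}

theorem ofReal_norm_sq {F : Type*} [NormedAddCommGroup F] (x : F) :
    ENNReal.ofReal (‖x‖ ^ 2) = ‖x‖ₑ ^ 2 := by
  rw [ENNReal.ofReal_pow (norm_nonneg _), ofReal_norm]

/-- The dissipation inequality without its term -2λV ≤ 0, integrated; both sides are sums, as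
subtraction in `ℝ≥0∞` truncates. -/
theorem lyap_flow_lintegral_le (h : LMIsFeasibleAt pl T₂ lam γ δ χ P₁ P₂ X U W J)
    (hL : J = Xᵀ * L) (hH : W = Uᵀ * H) (hT₁ : 0 < T₁) (hT : T₁ ≤ T₂) (hlam : 0 < lam)
    (hs : IsSolutionPair (closedLoop pl T₁ T₂ L H) D φ u) {j : ℕ}
    {a b : ℝ} (hab : a ≤ b) (hI : Icc a b ⊆ slice D j) :
    ENNReal.ofReal (lyap pl δ P₁ P₂ (φ b j)) + ∫⁻ t in Ioc a b, ‖app pl.Cp (φ t j).ε‖ₑ ^ 2 ≤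
      ENNReal.ofReal (lyap pl δ P₁ P₂ (φ a j)) +
        ENNReal.ofReal (γ ^ 2) * ∫⁻ t in Ioc a b, ‖(u t j).fst‖ₑ ^ 2 := by
  have hi1 : IntegrableOn (fun t => ‖app pl.Cp (φ t j).ε‖ ^ 2) (Ioc a b) := by
    have h1 := (hs.absolutelyContinuous_clm ((appL pl.Cp).comp State.εL) hab hI).continuousOn
    rw [uIcc_of_le hab] at h1
    exact ((h1.norm.pow 2).integrableOn_Icc).mono_set Ioc_subset_Icc_self
  have hi2 : IntegrableOn (fun t => ‖(u t j).fst‖ ^ 2) (Ioc a b) := by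
    obtain ⟨hm, hbd⟩ := hs.input j
    obtain ⟨M, hM⟩ := hbd a b hI
    have hm' : AEStronglyMeasurable (fun t => (u t j).fst) (volume.restrict (Ioc a b)) :=
      (WithLp.fstL 2 ℝ (E nw) (E ny)).continuous.comp_aestronglyMeasurable
        (hm.mono_measure (Measure.restrict_mono (Ioc_subset_Icc_self.trans hI) le_rfl))
    refine Integrable.of_bound (hm'.norm.pow 2) (M ^ 2) ?_
    filter_upwards [ae_restrict_of_ae_restrict_of_subset Ioc_subset_Icc_self hM] with t ht
    rw [Real.norm_of_nonneg (sq_nonneg _)]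
    exact pow_le_pow_left₀ (norm_nonneg _) ((WithLp.norm_fst_le _ _).trans ht) 2
  have hi3 : IntegrableOn (fun t => γ ^ 2 * ‖(u t j).fst‖ ^ 2 - ‖app pl.Cp (φ t j).ε‖ ^ 2)
      (Ioc a b) := (hi2.const_mul (γ ^ 2)).sub hi1
  have hmain := (lyap_absolutelyContinuous (δ := δ) (P₁ := P₁) (P₂ := P₂) hs hab
      hI).sub_le_integral (h := fun t => γ ^ 2 * ‖(u t j).fst‖ ^ 2 - ‖app pl.Cp (φ t j).ε‖ ^ 2)
    hab (by
      filter_upwards [lyap_ae_deriv_le h hL hH hT₁ hT hs hI] with t ht hm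
      refine ⟨(ht hm).1, (ht hm).2.trans ?_⟩
      have := mul_nonneg hlam.le (lyap_nonneg h (φ t j))
      linarith) hi3
  rw [integral_sub (hi2.const_mul _) hi1, integral_const_mul] at hmain
  have e1 := ofReal_integral_eq_lintegral_ofReal hi1 (Eventually.of_forall fun _ => sq_nonneg _)
  have e2 := ofReal_integral_eq_lintegral_ofReal hi2 (Eventually.of_forall fun _ => sq_nonneg _)
  simp only [ofReal_norm_sq] at e1 e2
  rw [← e1, ← e2, ← ENNReal.ofReal_mul (sq_nonneg γ),
    ← ENNReal.ofReal_add (lyap_nonneg h _) (integral_nonneg fun _ => sq_nonneg _),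
    ← ENNReal.ofReal_add (lyap_nonneg h _)
      (mul_nonneg (sq_nonneg γ) (integral_nonneg fun _ => sq_nonneg _))]
  exact ENNReal.ofReal_le_ofReal (by linarith)

theorem IsHybridTimeDomain.lintegral_inter_Iic (hD : IsHybridTimeDomain D) {j : ℕ} {a b : ℝ}
    (hab : a ≤ b) (hI : Icc a b ⊆ slice D j) (g : ℝ → ℕ → ℝ≥0∞) :
    ∫⁻ s in ordinaryTimes D ∩ Iic b, g s (firstIndex D s) =
      (∫⁻ s in ordinaryTimes D ∩ Iic a, g s (firstIndex D s)) + ∫⁻ s in Ioc a b, g s j := by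
  have h1 : ordinaryTimes D ∩ Iic b = ordinaryTimes D ∩ Iic a ∪ Ioc a b := by
    rw [← Iic_union_Ioc_eq_Iic hab, inter_union_distrib_left,
      inter_eq_right.2 (IsHybridTimeDomain.Ioc_subset_ordinaryTimes hI)]
  rw [h1, lintegral_union measurableSet_Ioc
    ((Iic_disjoint_Ioc le_rfl).mono_left inter_subset_right)]
  congr 1
  exact setLIntegral_congr_fun measurableSet_Ioc fun s hs => by rw [hD.firstIndex_eq hI hs]

/-- The dissipation inequality, integrated over the ordinary time up to a hybrid time. -/
theorem lyap_add_lintegral_le (h : LMIsFeasibleAt pl T₂ lam γ δ χ P₁ P₂ X U W J)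
    (hL : J = Xᵀ * L) (hH : W = Uᵀ * H) (hT₁ : 0 < T₁) (hT : T₁ ≤ T₂) (hlam : 0 < lam)
    (hs : IsSolutionPair (closedLoop pl T₁ T₂ L H) D φ u)
    (hz : IsZeroInput D (fun t j => (u t j).snd)) : ∀ p ∈ D,
    ENNReal.ofReal (lyap pl δ P₁ P₂ (φ p.1 p.2)) +
        ∫⁻ s in ordinaryTimes D ∩ Iic p.1, ‖app pl.Cp (φ s (firstIndex D s)).ε‖ₑ ^ 2 ≤
      ENNReal.ofReal (lyap pl δ P₁ P₂ (φ 0 0)) + ENNReal.ofReal (γ ^ 2) *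
        ∫⁻ s in ordinaryTimes D ∩ Iic p.1, ‖(u s (firstIndex D s)).fst‖ₑ ^ 2 := by
  refine hs.domain.induction (Q := fun t j => ENNReal.ofReal (lyap pl δ P₁ P₂ (φ t j)) +
        ∫⁻ s in ordinaryTimes D ∩ Iic t, ‖app pl.Cp (φ s (firstIndex D s)).ε‖ₑ ^ 2 ≤
      ENNReal.ofReal (lyap pl δ P₁ P₂ (φ 0 0)) + ENNReal.ofReal (γ ^ 2) *
        ∫⁻ s in ordinaryTimes D ∩ Iic t, ‖(u s (firstIndex D s)).fst‖ₑ ^ 2) ?_ ?_ ?_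
  · have h0 : volume (ordinaryTimes D ∩ Iic 0) = 0 := by
      refine measure_mono_null (t := {0}) ?_ (by simp)
      rintro s ⟨⟨j, hj⟩, hs0⟩
      exact le_antisymm hs0 (hs.domain.nonneg hj)
    simp only [setLIntegral_measure_zero _ _ h0, mul_zero, add_zero, le_refl]
  · intro j a b hab hI ha
    have h1 := lyap_flow_lintegral_le h hL hH hT₁ hT hlam hs hab hI
    rw [hs.domain.lintegral_inter_Iic hab hI (fun s j => ‖app pl.Cp (φ s j).ε‖ₑ ^ 2),
      hs.domain.lintegral_inter_Iic hab hI (fun s j => ‖(u s j).fst‖ₑ ^ 2), mul_add]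
    calc _ = (ENNReal.ofReal (lyap pl δ P₁ P₂ (φ b j)) +
            ∫⁻ t in Ioc a b, ‖app pl.Cp (φ t j).ε‖ₑ ^ 2) +
            ∫⁻ s in ordinaryTimes D ∩ Iic a, ‖app pl.Cp (φ s (firstIndex D s)).ε‖ₑ ^ 2 := by
          ring
      _ ≤ _ := add_le_add_left h1 _
      _ = (ENNReal.ofReal (lyap pl δ P₁ P₂ (φ a j)) +
            ∫⁻ s in ordinaryTimes D ∩ Iic a, ‖app pl.Cp (φ s (firstIndex D s)).ε‖ₑ ^ 2) +
            ENNReal.ofReal (γ ^ 2) * ∫⁻ t in Ioc a b, ‖(u t j).fst‖ₑ ^ 2 := by ring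
      _ ≤ _ := add_le_add_left ha _
      _ = _ := by ring
  · intro p hp ha
    refine le_trans (add_le_add_left (ENNReal.ofReal_le_ofReal ?_) _) ha
    have h1 := lyap_jump_le h hs hp
    have h2 : (u p.1 p.2).snd = 0 := hz p hp.1
    rwa [h2, inner_zero_left, mul_zero, add_zero] at h1

/-- The final value of V is dropped, the truncated bounds pass to the whole domain, and the square
root is subadditive; α = √c₂ comes from V ≤ c₂ dist² at the initial time. -/
theorem exists_l2_bound (h : LMIsFeasibleAt pl T₂ lam γ δ χ P₁ P₂ X U W J)
    (hL : J = Xᵀ * L) (hH : W = Uᵀ * H) (hT₁ : 0 < T₁) (hT : T₁ ≤ T₂) (hlam : 0 < lam)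
    (hγ : 0 < γ) :
    ∃ α > 0, ∀ D φ u, IsSolutionPair (closedLoop pl T₁ T₂ L H) D φ u →
      IsZeroInput D (fun t j => (u t j).snd) →
      l2Norm D (fun t j => app pl.Cp (φ t j).ε) ≤
        ENNReal.ofReal (α * Metric.infDist (φ 0 0) (target nz ny T₂)) +
          ENNReal.ofReal γ * l2Norm D (fun t j => (u t j).fst) := by
  obtain ⟨c₁, hc₁, c₂, hc₂, hV⟩ := exists_lyap_bounds h (hT₁.le.trans hT)
  refine ⟨√c₂, Real.sqrt_pos.2 hc₂, fun D φ u hs hz => ?_⟩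
  set d₀ := Metric.infDist (φ 0 0) (target nz ny T₂)
  have hd₀ : 0 ≤ d₀ := Metric.infDist_nonneg
  have hV₀ : lyap pl δ P₁ P₂ (φ 0 0) ≤ c₂ * d₀ ^ 2 :=
    (hV _ (τ_mem hs hT₁ hT _ hs.domain.zero_mem)).2
  set I := ∫⁻ s in ordinaryTimes D, ‖(u s (firstIndex D s)).fst‖ₑ ^ 2 with hIdef
  have hmain : ∫⁻ s in ordinaryTimes D, ‖app pl.Cp (φ s (firstIndex D s)).ε‖ₑ ^ 2 ≤
      ENNReal.ofReal ((√c₂ * d₀) ^ 2) + ENNReal.ofReal (γ ^ 2) * I := by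
    refine setLIntegral_le_of_forall_inter_Iic ?_
    rintro s ⟨j, hj⟩
    have h1 := lyap_add_lintegral_le h hL hH hT₁ hT hlam hs hz (s, j) hj
    refine (le_add_self.trans h1).trans (add_le_add (ENNReal.ofReal_le_ofReal ?_)
      (mul_le_mul_right (lintegral_mono_set inter_subset_left) _))
    rw [mul_pow, Real.sq_sqrt hc₂.le]
    exact hV₀
  have hroot : ∀ r : ℝ, 0 ≤ r → ENNReal.ofReal (r ^ 2) ^ (1 / 2 : ℝ) = ENNReal.ofReal r := by
    intro r hr
    rw [ENNReal.ofReal_rpow_of_nonneg (sq_nonneg r) (by norm_num), ← Real.sqrt_eq_rpow,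
      Real.sqrt_sq hr]
  calc l2Norm D (fun t j => app pl.Cp (φ t j).ε)
      ≤ (ENNReal.ofReal ((√c₂ * d₀) ^ 2) + ENNReal.ofReal (γ ^ 2) * I) ^ (1 / 2 : ℝ) :=
        ENNReal.rpow_le_rpow hmain (by norm_num)
    _ ≤ ENNReal.ofReal ((√c₂ * d₀) ^ 2) ^ (1 / 2 : ℝ) +
          (ENNReal.ofReal (γ ^ 2) * I) ^ (1 / 2 : ℝ) :=
        ENNReal.rpow_add_le_add_rpow _ _ (by norm_num) (by norm_num)
    _ = _ := by
        rw [ENNReal.mul_rpow_of_nonneg _ _ (by norm_num), hroot _ hγ.le,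
          hroot _ (mul_nonneg (Real.sqrt_nonneg _) hd₀)]
        rfl

end SporadicObserver

/-! ### Assembly, and a feasible example with δ < 2λ_t -/

namespace SporadicObserver

theorem solvesEstimationProblem {nz ny nw nq ns np : ℕ} {pl : Plant nz ny nw nq ns np}
    {T₁ T₂ lam γ δ χ : ℝ} {P₁ : Matrix (Fin nz) (Fin nz) ℝ} {P₂ : Matrix (Fin ny) (Fin ny) ℝ}
    {X : Matrix (Fin nz) (Fin nz) ℝ} {U W : Matrix (Fin ny) (Fin ny) ℝ}
    {J : Matrix (Fin nz) (Fin ny) ℝ} {L : Matrix (Fin nz) (Fin ny) ℝ}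
    {H : Matrix (Fin ny) (Fin ny) ℝ}
    (h : LMIsFeasibleAt pl T₂ lam γ δ χ P₁ P₂ X U W J)
    (hL : J = Xᵀ * L) (hH : W = Uᵀ * H) (hT₁ : 0 < T₁) (hT : T₁ ≤ T₂) (hlam : 0 < lam)
    (hγ : 0 < γ) : SolvesEstimationProblem pl T₁ T₂ lam γ L H where
  exp_stable := isGloballyExpStable_closedLoop h hL hH hT₁ hT hlam
  exp_iss := isExpISS_closedLoop h hL hH hT₁ hT hlam
  error_bounded _ _ _ hs hu := exists_error_bound h hL hH hT₁ hT hlam hs hu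
  l2_stable := exists_l2_bound h hL hH hT₁ hT hlam hγ

section Example

open Matrix

/-- The scalar plant `ż = -z + ψ(z / 2) / 2 + w`, `y = z + η`, `y_p = z - ẑ`, with `ψ` the
identity. -/
def scalarPlant : Plant 1 1 1 1 1 1 where
  A := -1
  B := (1 / 2 : ℝ) • 1
  C := 1
  N := 1
  S := (1 / 2 : ℝ) • 1
  Cp := 1
  ψ := id
  ℓ := 1
  ℓ_pos := one_pos
  lipschitz v₁ v₂ := by simp

theorem isHermitian_lmiMatrix {nz ny nw nq ns np : ℕ} (pl : Plant nz ny nw nq ns np)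
    (lam γ δ χ e : ℝ) {P₁ : Matrix (Fin nz) (Fin nz) ℝ} {P₂ : Matrix (Fin ny) (Fin ny) ℝ}
    (hP₁ : P₁.IsHermitian) (hP₂ : P₂.IsHermitian)
    (X : Matrix (Fin nz) (Fin nz) ℝ) (U W : Matrix (Fin ny) (Fin ny) ℝ)
    (J : Matrix (Fin nz) (Fin ny) ℝ) :
    (lmiMatrix pl lam γ δ χ e P₁ P₂ X U W J).IsHermitian := by
  rw [IsHermitian, conjTranspose_eq_transpose_of_trivial] at *
  simp [lmiMatrix, He, fromBlocks_transpose, hP₁, hP₂, add_comm]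

theorem posDef_smul_one {n : ℕ} {r : ℝ} (hr : 0 < r) :
    (r • (1 : Matrix (Fin n) (Fin n) ℝ)).PosDef :=
  PosDef.one.smul hr

/-- The quadratic form of `lmiMatrix` for `scalarPlant` and the values of the variables used
below. -/
theorem scalarForm_le {e : ℝ} (he : e = 1 ∨ e = 11 / 10) (a b c d w ζ : ℝ) :
    10 * a * c + 8 * e * b * d + 8 * c ^ 2 + 2 * e * d ^ 2 - 25 * w ^ 2 - 8 * ζ ^ 2
      + 2 * (13 * (-c + ζ / 2 + w - a) * (a + c) + 3 * (a + c) * (d - c))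
      + 2 * (11 / 2 * (b + d) * a - 11 / 2 * b * (b + d) - 5 * (b + d) * (d - c)) ≤
      -(1 / 4) * (a ^ 2 + b ^ 2 + c ^ 2 + d ^ 2 + w ^ 2 + ζ ^ 2) := by
  rcases he with rfl | rfl
  -- Successive completion of squares, eliminating w, ζ, a, b, c, d in turn from the form plus a
  -- quarter of the squared norm.
  · have h1 := sq_nonneg (w - 52 / 99 * a - 52 / 99 * c)
    have h2 := sq_nonneg (ζ - 26 / 31 * a - 26 / 31 * c)
    have h3 := sq_nonneg (a - 67518 / 165359 * b + 143876 / 165359 * c - 6138 / 9727 * d)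
    have h4 := sq_nonneg (b - 141908 / 5625041 * c + 2003722 / 5625041 * d)
    have h5 := sq_nonneg (c - 11877232 / 28512931 * d)
    have h6 := sq_nonneg d
    linarith
  · have h1 := sq_nonneg (w - 52 / 99 * a - 52 / 99 * c)
    have h2 := sq_nonneg (ζ - 26 / 31 * a - 26 / 31 * c)
    have h3 := sq_nonneg (a - 67518 / 165359 * b + 143876 / 165359 * c - 6138 / 9727 * d)
    have h4 := sq_nonneg (b - 141908 / 5625041 * c + 8695738 / 28125205 * d)
    have h5 := sq_nonneg (c - 60521424 / 142564655 * d)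
    have h6 := sq_nonneg d
    linarith

theorem negDef_lmiMatrix_scalarPlant {e : ℝ} (he : e = 1 ∨ e = 11 / 10) :
    NegDef (lmiMatrix scalarPlant (1 / 2) 5 (1 / 2) 8 e ((5 : ℝ) • 1) ((4 : ℝ) • 1)
      ((13 : ℝ) • 1) ((11 / 2 : ℝ) • 1) ((-5 : ℝ) • 1) ((3 : ℝ) • 1)) := by
  rw [NegDef, posDef_iff_dotProduct_mulVec]
  refine ⟨(isHermitian_lmiMatrix _ _ _ _ _ _ (posDef_smul_one (by norm_num)).isHermitian
    (posDef_smul_one (by norm_num)).isHermitian _ _ _ _).neg, fun v hv => ?_⟩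
  obtain ⟨a, b, c, d, w, ζ, rfl⟩ : ∃ a b c d w ζ : Fin 1 → ℝ,
      v = Sum.elim (Sum.elim (Sum.elim a b) (Sum.elim c d)) (Sum.elim w ζ) :=
    ⟨fun i => v (.inl (.inl (.inl i))), fun i => v (.inl (.inl (.inr i))),
      fun i => v (.inl (.inr (.inl i))), fun i => v (.inl (.inr (.inr i))),
      fun i => v (.inr (.inl i)), fun i => v (.inr (.inr i)),
      by ext ((((i | i) | (i | i))) | (i | i)) <;> rfl⟩
  rw [star_trivial, neg_mulVec, dotProduct_neg, lmiMatrix_quadForm]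
  have hpos : 0 < a 0 ^ 2 + b 0 ^ 2 + c 0 ^ 2 + d 0 ^ 2 + w 0 ^ 2 + ζ 0 ^ 2 := by
    by_contra! hle
    have h0 : a 0 = 0 ∧ b 0 = 0 ∧ c 0 = 0 ∧ d 0 = 0 ∧ w 0 = 0 ∧ ζ 0 = 0 := by
      refine ⟨?_, ?_, ?_, ?_, ?_, ?_⟩ <;> nlinarith
    obtain ⟨ha, hb, hc, hd, hw, hζ⟩ := h0
    refine hv (funext ?_)
    rintro ((((i | i) | (i | i))) | (i | i)) <;> rw [Subsingleton.elim i 0] <;> assumption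
  have hle := scalarForm_le he (a 0) (b 0) (c 0) (d 0) (w 0) (ζ 0)
  simp [scalarPlant, dotProduct, mulVec, -neg_add_rev]
  linarith

end Example
end SporadicObserver

end

open SporadicObserver in
theorem proposition4 :
    (∀ {nz ny nw nq ns np : ℕ} (pl : Plant nz ny nw nq ns np) (T₁ T₂ lam γ : ℝ),
      0 < T₁ → T₁ ≤ T₂ → 0 < lam → 0 < γ →
      ∀ (δ χ : ℝ) (P₁ : Matrix (Fin nz) (Fin nz) ℝ) (P₂ : Matrix (Fin ny) (Fin ny) ℝ)
        (X : Matrix (Fin nz) (Fin nz) ℝ) (U W : Matrix (Fin ny) (Fin ny) ℝ)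
        (J : Matrix (Fin nz) (Fin ny) ℝ),
        LMIsFeasibleAt pl T₂ lam γ δ χ P₁ P₂ X U W J →
        IsUnit X.det ∧ IsUnit U.det ∧
          SolvesEstimationProblem pl T₁ T₂ lam γ ((Xᵀ)⁻¹ * J) ((Uᵀ)⁻¹ * W)) ∧
    (∃ (nz ny nw nq ns np : ℕ) (pl : Plant nz ny nw nq ns np) (T₂ lam γ δ χ : ℝ)
        (P₁ : Matrix (Fin nz) (Fin nz) ℝ) (P₂ : Matrix (Fin ny) (Fin ny) ℝ)
        (X : Matrix (Fin nz) (Fin nz) ℝ) (U W : Matrix (Fin ny) (Fin ny) ℝ)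
        (J : Matrix (Fin nz) (Fin ny) ℝ),
        0 < nz ∧ 0 < ny ∧ 0 < T₂ ∧ 0 < lam ∧ 0 < γ ∧ δ < 2 * lam ∧
        LMIsFeasibleAt pl T₂ lam γ δ χ P₁ P₂ X U W J) := by
  constructor
  · intro nz ny nw nq ns np pl T₁ T₂ lam γ hT₁ hT hlam hγ δ χ P₁ P₂ X U W J h
    refine ⟨h.isUnit_det_X, h.isUnit_det_U, solvesEstimationProblem h ?_ ?_ hT₁ hT hlam hγ⟩
    · rw [Matrix.mul_nonsing_inv_cancel_left]
      rw [Matrix.det_transpose]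
      exact h.isUnit_det_X
    · rw [Matrix.mul_nonsing_inv_cancel_left]
      rw [Matrix.det_transpose]
      exact h.isUnit_det_U
  -- Here δ = 1/2 < 1 = 2λ_t, and T₂ is chosen so that e^{δT₂} = 11/10 is rational.
  · refine ⟨1, 1, 1, 1, 1, 1, scalarPlant, 2 * Real.log (11 / 10), 1 / 2, 5, 1 / 2, 8, (5 : ℝ) • 1,
      (4 : ℝ) • 1, (13 : ℝ) • 1, (11 / 2 : ℝ) • 1, (-5 : ℝ) • 1, (3 : ℝ) • 1, one_pos, one_pos,
      mul_pos two_pos (Real.log_pos (by norm_num)), by norm_num, by norm_num, by norm_num, ?_⟩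
    refine ⟨posDef_smul_one (by norm_num), posDef_smul_one (by norm_num), by norm_num, by norm_num,
      negDef_lmiMatrix_scalarPlant (Or.inl rfl), negDef_lmiMatrix_scalarPlant (Or.inr ?_)⟩
    rw [← mul_assoc, div_mul_cancel₀ _ two_ne_zero, one_mul, Real.exp_log (by norm_num)]
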